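/- Let $n\ge 1$ and let $T\subseteq\mathbb{R}$ be one of (i) $T=[a,b]$ with $a<b$, (ii) $T=[a,\infty)$, (iii) $T=\mathbb{R}$, where in case (iii) $n$ is assumed even. Let $$K_n=\Bigl\{c=(c_0,\dots,c_n)\in\mathbb{R}^{n+1} : \sum_{i=0}^n c_it^i\ge 0 \text{ for all } t\in T\Bigr\},$$ let $\mathbb{R}_+=(0,\infty)$, and let $$\Delta_{n-1}=\{\gamma=(\gamma_1,\dots,\gamma_{n-1})\in(\mathrm{int}\,T)^{n-1} : \gamma_1<\dots<\gamma_{n-1}\},$$ where for $n=1$ the set $\Delta_0$ is a single point (the empty tuple). For $\alpha=(\alpha_1,\alpha_2)\in\mathbb{R}_+^2$ and $\gamma\in\Delta_{n-1}$ let $\varphi_n(\alpha,\gamma)\in\mathbb{R}^{n+1}$ be the vector of coefficients (of $1,t,\dots,t^n$) of the following polynomial $p_n(t;\alpha,\gamma)$, with empty products equal to $1$: (i) if $T=[a,b]$, $$p_n(t;\alpha,\gamma)=\begin{cases}\alpha_1\prod_{j=1}^m(t-\gamma_{2j-1})^2+\alpha_2(t-a)(b-t)\prod_{j=1}^{m-1}(t-\gamma_{2j})^2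 & (n=2m),\\ \alpha_1(t-a)\prod_{j=1}^m(t-\gamma_{2j})^2+\alpha_2(b-t)\prod_{j=1}^m(t-\gamma_{2j-1})^2 & (n=2m+1);\end{cases}$$ (ii) if $T=[a,\infty)$, $$p_n(t;\alpha,\gamma)=\begin{cases}\alpha_1\prod_{j=1}^m(t-\gamma_{2j-1})^2+\alpha_2(t-a)\prod_{j=1}^{m-1}(t-\gamma_{2j})^2 & (n=2m),\\ \alpha_1(t-a)\prod_{j=1}^m(t-\gamma_{2j})^2+\alpha_2\prod_{j=1}^m(t-\gamma_{2j-1})^2 & (n=2m+1);\end{cases}$$ (iii) if $T=\mathbb{R}$ and $n=2m$, $$p_n(t;\alpha,\gamma)=\alpha_1\prod_{j=1}^m(t-\gamma_{2j-1})^2+\alpha_2\prod_{j=1}^{m-1}(t-\gamma_{2j})^2.$$ Then $K_n=\varphi_n(\mathbb{R}_+^2\times\Delta_{n-1})$ up to a set of $(n+1)$-dimensional Lebesgue measure zero. Moreover $\varphi_n$ is injective on $\mathbb{R}_+^2\times\Delta_{n-1}$ (the representation is unique), and it is a $C^\infty$ diffeomorphism of the open set $\mathbb{R}_+^2\times\Delta_{n-1}$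 onto its image, which is an open subset of $\mathbb{R}^{n+1}$. -/

import Mathlib

open Set MeasureTheory
open scoped Polynomial ContDiff

noncomputable section

namespace PositivePolynomial

/-- The cone `K_n` of coefficient vectors `c = (c_0, …, c_n)` of polynomials
`c_0 + c_1 t + ⋯ + c_n t ^ n` that are nonnegative on `T`. -/
def cone (n : ℕ) (T : Set ℝ) : Set (Fin (n + 1) → ℝ) :=
  {c | ∀ t ∈ T, 0 ≤ ∑ i : Fin (n + 1), c i * t ^ (i : ℕ)}

/-- The set `Δ_m` of strictly increasing `m`-tuples of interior points of `T`.
For `m = 0` this is a one-point set. -/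
def Simplex (m : ℕ) (T : Set ℝ) : Set (Fin m → ℝ) :=
  {γ | (∀ i, γ i ∈ interior T) ∧ StrictMono γ}

/-- The parameter domain `ℝ₊² × Δ_{n-1}`, where `ℝ₊ = (0, ∞)`. -/
def paramDomain (n : ℕ) (T : Set ℝ) : Set ((ℝ × ℝ) × (Fin (n - 1) → ℝ)) :=
  (Ioi (0 : ℝ) ×ˢ Ioi (0 : ℝ)) ×ˢ Simplex (n - 1) T

/-- `∏ (t - γ_k) ^ 2` over the odd `k` in `1, …, r`
(`γ_k` is `γ i` for the zero-based index `i = k - 1`, so `i` is even). -/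
def oddSq {r : ℕ} (γ : Fin r → ℝ) : ℝ[X] :=
  ∏ i ∈ Finset.univ.filter (fun i : Fin r => Even i.val), (Polynomial.X - Polynomial.C (γ i)) ^ 2

/-- `∏ (t - γ_k) ^ 2` over the even `k` in `1, …, r`
(`γ_k` is `γ i` for the zero-based index `i = k - 1`, so `i` is odd). -/
def evenSq {r : ℕ} (γ : Fin r → ℝ) : ℝ[X] :=
  ∏ i ∈ Finset.univ.filter (fun i : Fin r => Odd i.val), (Polynomial.X - Polynomial.C (γ i)) ^ 2

/-- The polynomial `p_n(t; α, γ)` for `T = [a, b]`. -/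
def polyIcc (n : ℕ) (a b : ℝ) (x : (ℝ × ℝ) × (Fin (n - 1) → ℝ)) : ℝ[X] :=
  if Even n then
    Polynomial.C x.1.1 * oddSq x.2 +
      Polynomial.C x.1.2 * (Polynomial.X - Polynomial.C a) *
        (Polynomial.C b - Polynomial.X) * evenSq x.2
  else
    Polynomial.C x.1.1 * (Polynomial.X - Polynomial.C a) * evenSq x.2 +
      Polynomial.C x.1.2 * (Polynomial.C b - Polynomial.X) * oddSq x.2

/-- The polynomial `p_n(t; α, γ)` for `T = [a, ∞)`. -/
def polyIci (n : ℕ) (a : ℝ) (x : (ℝ × ℝ) × (Fin (n - 1) → ℝ)) : ℝ[X] :=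
  if Even n then
    Polynomial.C x.1.1 * oddSq x.2 +
      Polynomial.C x.1.2 * (Polynomial.X - Polynomial.C a) * evenSq x.2
  else
    Polynomial.C x.1.1 * (Polynomial.X - Polynomial.C a) * evenSq x.2 +
      Polynomial.C x.1.2 * oddSq x.2

/-- The polynomial `p_n(t; α, γ)` for `T = ℝ` (used for even `n`). -/
def polyUniv (n : ℕ) (x : (ℝ × ℝ) × (Fin (n - 1) → ℝ)) : ℝ[X] :=
  Polynomial.C x.1.1 * oddSq x.2 + Polynomial.C x.1.2 * evenSq x.2

/-- The vector of the coefficients of `1, t, …, t ^ n` in a polynomial. -/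
def coeffVec (n : ℕ) (p : ℝ[X]) : Fin (n + 1) → ℝ := fun i => p.coeff i

/-- `f` restricts to a (smooth) diffeomorphism of the open set `s` onto the open set `t`. -/
def IsDiffeoOn {E F : Type*} [NormedAddCommGroup E] [NormedSpace ℝ E]
    [NormedAddCommGroup F] [NormedSpace ℝ F] (f : E → F) (s : Set E) (t : Set F) : Prop :=
  IsOpen s ∧ IsOpen t ∧ BijOn f s t ∧ ContDiffOn ℝ ∞ f s ∧
    ∃ g : F → E, LeftInvOn g f s ∧ ContDiffOn ℝ ∞ g t

/-- `φ` is an almost everywhere representation of `K_n` on `T`: the cone equals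
`φ (ℝ₊² × Δ_{n-1})` up to a Lebesgue null set, the parameters are uniquely determined by
the value of `φ`, and `φ` is a diffeomorphism of `ℝ₊² × Δ_{n-1}` onto its image. -/
def IsAERepresentation (n : ℕ) (T : Set ℝ)
    (φ : (ℝ × ℝ) × (Fin (n - 1) → ℝ) → Fin (n + 1) → ℝ) : Prop :=
  cone n T =ᵐ[volume] φ '' paramDomain n T ∧
    InjOn φ (paramDomain n T) ∧
    IsDiffeoOn φ (paramDomain n T) (φ '' paramDomain n T)

end PositivePolynomial

end

noncomputable section

namespace PositivePolynomial

open Polynomial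

/-! With n = r + 1, every case has the form f = α u P² + β v Q², where P and Q are monic with the
odd- and even-numbered nodes as zeros, and u, v are coprime weights, nonnegative on T; for odd n the
two weights α, β are exchanged. The proof is a continuity argument: the image of the parameter
domain is exactly `posCone`, the set of polynomials positive on T whose top coefficient is also
positive if T is unbounded above. This set is convex, hence connected, and the image is nonempty,
open and relatively closed in it. The set `posCone` contains the interior of the convex cone K_n and
lies in K_n, so the two differ only inside a frontier of measure zero.

Openness comes from the inverse function theorem. A kernel vector of the derivative gives u P R + v
Q S = 0 with R, S of small degree; coprimality of u P and v Q forces R = S = 0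
(`Admissible.variation_eq_zero`).

Uniqueness: absorb √α, √β into P, Q. Two representations of f give u (PQ' - P'Q)(PQ' + P'Q) = f (Q'²
- Q²). The factor PQ' + P'Q has no zero off T: nonreal zeros are excluded by an argument estimate
(`alternating_im_pos`), real ones by signs. As f > 0 on T, f is coprime to this factor and so
divides PQ' - P'Q; a degree count makes the quotient zero.

Closedness: along a sequence whose images converge in `posCone` the parameters stay bounded
(`Admissible.eventually_mem_box`). A limit on the boundary of the domain would make f vanish at some
point of T or lose its top coefficient (`Admissible.mem_paramDomain_of_mem_posCone`). -/

/-! ### Odd- and even-numbered nodes -/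

/-- The zero-based indices of the nodes with an odd number. -/
abbrev oddNodes (r : ℕ) : Finset (Fin r) := Finset.univ.filter fun i => Even i.val

/-- The zero-based indices of the nodes with an even number. -/
abbrev evenNodes (r : ℕ) : Finset (Fin r) := Finset.univ.filter fun i => Odd i.val

theorem card_oddNodes_and_evenNodes (r : ℕ) :
    (oddNodes r).card = (r + 1) / 2 ∧ (evenNodes r).card = r / 2 := by
  induction r with
  | zero => simp
  | succ r ih =>
    rw [oddNodes, evenNodes, Fin.card_filter_univ_succ, Fin.card_filter_univ_succ]
    have h1 : (Finset.univ.filter fun i : Fin r => Even i.succ.val) = evenNodes r := by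
      ext i; simp [Nat.even_add_one]
    have h2 : (Finset.univ.filter fun i : Fin r => Odd i.succ.val) = oddNodes r := by
      ext i; simp [Nat.odd_add_one]
    rw [h1, h2, ih.1, ih.2, if_pos (by simp), if_neg (by simp)]
    omega

theorem card_oddNodes (r : ℕ) : (oddNodes r).card = (r + 1) / 2 :=
  (card_oddNodes_and_evenNodes r).1

theorem card_evenNodes (r : ℕ) : (evenNodes r).card = r / 2 :=
  (card_oddNodes_and_evenNodes r).2

theorem disjoint_oddNodes_evenNodes (r : ℕ) : Disjoint (oddNodes r) (evenNodes r) := by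
  rw [Finset.disjoint_left]
  intro i hi hj
  simp only [Finset.mem_filter, Finset.mem_univ, true_and] at hi hj
  exact (Nat.not_even_iff_odd.2 hj) hi

theorem oddSq_eq {r : ℕ} (γ : Fin r → ℝ) : oddSq γ = Lagrange.nodal (oddNodes r) γ ^ 2 :=
  Finset.prod_pow _ _ _

theorem evenSq_eq {r : ℕ} (γ : Fin r → ℝ) : evenSq γ = Lagrange.nodal (evenNodes r) γ ^ 2 :=
  Finset.prod_pow _ _ _

/-- The argument of the alternating quotient of the factors `z - γ i` at a point `z` of the upper
half plane stays in a half plane that depends on the number of factors only. -/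
theorem alternating_im_pos {z : ℂ} (hz : 0 < z.im) (r : ℕ) (γ : Fin (r + 1) → ℝ)
    (hγ : StrictMono γ) :
    0 < (-1) ^ r * ((∏ i ∈ oddNodes (r + 1), (z - γ i)) *
        (starRingEnd ℂ) (∏ i ∈ evenNodes (r + 1), (z - γ i))).im ∧
      (-1) ^ r * ((z - γ 0) * (starRingEnd ℂ) ((∏ i ∈ oddNodes (r + 1), (z - γ i)) *
        (starRingEnd ℂ) (∏ i ∈ evenNodes (r + 1), (z - γ i)))).im ≤ 0 := by
  have key : ∀ (r : ℕ) (γ : Fin (r + 1) → ℝ),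
      (∏ i ∈ oddNodes (r + 1), (z - γ i)) =
        (z - γ 0) * ∏ i ∈ evenNodes r, (z - γ i.succ) ∧
      (∏ i ∈ evenNodes (r + 1), (z - γ i)) = ∏ i ∈ oddNodes r, (z - γ i.succ) := by
    intro r γ
    simp only [oddNodes, evenNodes, Finset.prod_filter, Fin.prod_univ_succ]
    simp [Nat.even_add_one, Nat.odd_add_one]
  -- Put W = N · conj D. Peeling off the first node turns W' of the remaining nodes into W = (z - γ
  -- 0) · conj W'. The second inequality is carried along because the sign of Im W' alone does not
  -- control Im W.
  induction r with
  | zero =>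
    rw [(key 0 γ).1, (key 0 γ).2, Finset.prod_of_isEmpty, Finset.prod_of_isEmpty]
    simp only [pow_zero, mul_one, map_one, one_mul, Complex.mul_conj,
      Complex.ofReal_im, le_refl, and_true]
    simpa using hz
  | succ r ih =>
    obtain ⟨h1, h2⟩ := ih (fun i => γ i.succ) (hγ.comp (Fin.strictMono_succ))
    rw [(key _ γ).1, (key _ γ).2]
    have hlt : γ 0 < γ (Fin.succ 0) := hγ (Fin.succ_pos 0)
    set N := ∏ i ∈ oddNodes (r + 1), (z - γ i.succ)
    set D := ∏ i ∈ evenNodes (r + 1), (z - γ i.succ)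
    set s : ℝ := (-1) ^ r
    have hs : (-1 : ℝ) ^ (r + 1) = -s := by rw [pow_succ]; ring
    rw [hs]
    simp only [map_mul, Complex.conj_conj, Complex.mul_im, Complex.mul_re, Complex.sub_re,
      Complex.sub_im, Complex.ofReal_re, Complex.ofReal_im, Complex.conj_re, Complex.conj_im,
      map_sub, Complex.conj_ofReal] at h1 h2 ⊢
    constructor
    -- Split z - γ 0 = (z - γ 1) + (γ 1 - γ 0): the first summand is the second induction
    -- hypothesis, the second gives strictness.
    · nlinarith [mul_pos (sub_pos.2 hlt) h1]
    · nlinarith [mul_nonneg (add_nonneg (sq_nonneg (z.re - γ 0)) (sq_nonneg z.im)) h1.le]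

/-! ### The common form of the three cases -/

/-- The product of `X - γ_k` over the odd `k`. -/
def oddProd {r : ℕ} (γ : Fin r → ℝ) : ℝ[X] := Lagrange.nodal (oddNodes r) γ

/-- The product of `X - γ_k` over the even `k`. -/
def evenProd {r : ℕ} (γ : Fin r → ℝ) : ℝ[X] := Lagrange.nodal (evenNodes r) γ

/-- The polynomial `α u P² + β v Q²` with `P` and `Q` the products of `X - γ_k` over the odd and
over the even `k`. -/
def weightedPoly {r : ℕ} (u v : ℝ[X]) (x : (ℝ × ℝ) × (Fin r → ℝ)) : ℝ[X] :=
  C x.1.1 * u * oddProd x.2 ^ 2 + C x.1.2 * v * evenProd x.2 ^ 2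

/-- Conditions on a closed interval `T` and on weights `u`, `v` under which `weightedPoly u v`
parametrizes the positive polynomials of degree at most `r + 1` on `T`. -/
structure Admissible (r : ℕ) (T : Set ℝ) (u v : ℝ[X]) : Prop where
  ordConnected : T.OrdConnected
  isClosed : IsClosed T
  nonempty_interior : (interior T).Nonempty
  u_nonneg : ∀ t ∈ T, 0 ≤ u.eval t
  v_nonneg : ∀ t ∈ T, 0 ≤ v.eval t
  u_pos : ∀ t ∈ interior T, 0 < u.eval t
  v_pos : ∀ t ∈ interior T, 0 < v.eval t
  isCoprime : IsCoprime u v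
  natDegree_u : u.natDegree + 2 * ((r + 1) / 2) ≤ r + 1
  natDegree_v : v.natDegree + 2 * (r / 2) ≤ r + 1
  -- For even r the degree counts need the extra degree of v; for odd r parity alone suffices.
  odd_or : Odd r ∨ v.natDegree = 1
  boundary : ∀ t ∈ T, t ∈ interior T ∨ IsLeast T t ∨ IsGreatest T t
  eval_least : ∀ t, IsLeast T t → v.eval t = 0
  eval_greatest_odd : Odd r → ∀ t, IsGreatest T t → v.eval t = 0
  eval_greatest_even : Even r → ∀ t, IsGreatest T t → u.eval t = 0
  u_eq_one : ¬ BddAbove T → u = 1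
  natDegree_v_le : ¬ BddAbove T → v.natDegree ≤ 1
  v_monic : ¬ BddAbove T → Even r → v.Monic
  bddBelow_or : BddBelow T ∨ (Odd r ∧ ¬ BddAbove T)

theorem oddProd_monic {r : ℕ} (γ : Fin r → ℝ) : (oddProd γ).Monic := Lagrange.nodal_monic

theorem evenProd_monic {r : ℕ} (γ : Fin r → ℝ) : (evenProd γ).Monic := Lagrange.nodal_monic

theorem natDegree_oddProd {r : ℕ} (γ : Fin r → ℝ) : (oddProd γ).natDegree = (r + 1) / 2 := by
  rw [oddProd, Lagrange.natDegree_nodal, card_oddNodes]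

theorem natDegree_evenProd {r : ℕ} (γ : Fin r → ℝ) : (evenProd γ).natDegree = r / 2 := by
  rw [evenProd, Lagrange.natDegree_nodal, card_evenNodes]

theorem natDegree_weightedPoly_le {r : ℕ} {T : Set ℝ} {u v : ℝ[X]} (h : Admissible r T u v)
    (x : (ℝ × ℝ) × (Fin r → ℝ)) : (weightedPoly u v x).natDegree ≤ r + 1 := by
  have h1 := h.natDegree_u
  have h2 := h.natDegree_v
  refine natDegree_add_le_of_degree_le ?_ ?_
  · refine natDegree_mul_le.trans ?_
    have := natDegree_C_mul_le x.1.1 u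
    rw [natDegree_pow, natDegree_oddProd]
    omega
  · refine natDegree_mul_le.trans ?_
    have := natDegree_C_mul_le x.1.2 v
    rw [natDegree_pow, natDegree_evenProd]
    omega

theorem isCoprime_nodal {ι : Type*} {s : Finset ι} {γ : ι → ℝ} {w : ℝ[X]}
    (h : ∀ i ∈ s, w.eval (γ i) ≠ 0) : IsCoprime (Lagrange.nodal s γ) w := by
  refine IsCoprime.prod_left fun i hi => ?_
  rw [(irreducible_X_sub_C (γ i)).coprime_iff_not_dvd, dvd_iff_isRoot]
  exact h i hi

theorem eval_evenProd_ne_zero {r : ℕ} {γ : Fin r → ℝ} (hγ : StrictMono γ) {i : Fin r}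
    (hi : i ∈ oddNodes r) : (evenProd γ).eval (γ i) ≠ 0 := by
  refine Lagrange.eval_nodal_not_at_node fun j hj hij => ?_
  exact Finset.disjoint_left.1 (disjoint_oddNodes_evenNodes r) hi (hγ.injective hij ▸ hj)

theorem isCoprime_oddProd_evenProd {r : ℕ} {γ : Fin r → ℝ} (hγ : StrictMono γ) :
    IsCoprime (oddProd γ) (evenProd γ) :=
  isCoprime_nodal fun _ hi => eval_evenProd_ne_zero hγ hi

theorem Admissible.isCoprime_mul {r : ℕ} {T : Set ℝ} {u v : ℝ[X]} (h : Admissible r T u v)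
    {γ : Fin r → ℝ} (hγ : γ ∈ Simplex r T) : IsCoprime (u * oddProd γ) (v * evenProd γ) := by
  refine IsCoprime.mul_left (IsCoprime.mul_right h.isCoprime ?_) (IsCoprime.mul_right ?_ ?_)
  · exact (isCoprime_nodal fun i _ => (h.u_pos _ (hγ.1 i)).ne').symm
  · exact isCoprime_nodal fun i _ => (h.v_pos _ (hγ.1 i)).ne'
  · exact isCoprime_oddProd_evenProd hγ.2

theorem eval_weightedPoly {r : ℕ} (u v : ℝ[X]) (x : (ℝ × ℝ) × (Fin r → ℝ)) (t : ℝ) :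
    (weightedPoly u v x).eval t = x.1.1 * u.eval t * (oddProd x.2).eval t ^ 2 +
      x.1.2 * v.eval t * (evenProd x.2).eval t ^ 2 := by
  simp [weightedPoly]

/-- Both terms are nonnegative, and they vanish together only at a common zero of u P and v Q, which
a Bézout relation excludes. -/
theorem Admissible.eval_weightedPoly_pos {r : ℕ} {T : Set ℝ} {u v : ℝ[X]}
    (h : Admissible r T u v) {x : (ℝ × ℝ) × (Fin r → ℝ)} (h1 : 0 < x.1.1) (h2 : 0 < x.1.2)
    (hγ : x.2 ∈ Simplex r T) {t : ℝ} (ht : t ∈ T) : 0 < (weightedPoly u v x).eval t := by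
  rw [eval_weightedPoly]
  have hu := h.u_nonneg t ht
  have hv := h.v_nonneg t ht
  have hP : 0 ≤ x.1.1 * u.eval t * (oddProd x.2).eval t ^ 2 := by positivity
  have hQ : 0 ≤ x.1.2 * v.eval t * (evenProd x.2).eval t ^ 2 := by positivity
  refine lt_of_le_of_ne (add_nonneg hP hQ) fun h0 => ?_
  obtain ⟨p, q, hpq⟩ := h.isCoprime_mul hγ
  have e1 : (u * oddProd x.2).eval t = 0 := by
    have : x.1.1 * u.eval t * (oddProd x.2).eval t ^ 2 = 0 := by linarith
    simpa [h1.ne'] using this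
  have e2 : (v * evenProd x.2).eval t = 0 := by
    have : x.1.2 * v.eval t * (evenProd x.2).eval t ^ 2 = 0 := by linarith
    simpa [h2.ne'] using this
  have := congrArg (eval t) hpq
  rw [eval_add, eval_mul (p := p), eval_mul (p := q), e1, e2] at this
  simp at this

theorem mem_paramDomain {r : ℕ} {T : Set ℝ} {x : (ℝ × ℝ) × (Fin r → ℝ)} :
    x ∈ (Ioi (0 : ℝ) ×ˢ Ioi (0 : ℝ)) ×ˢ Simplex r T ↔
      0 < x.1.1 ∧ 0 < x.1.2 ∧ x.2 ∈ Simplex r T := by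
  simp [Set.mem_prod, and_assoc]

/-! ### Zeros of P Q' + P' Q -/

theorem aeval_nodal {ι : Type*} (s : Finset ι) (γ : ι → ℝ) (z : ℂ) :
    aeval z (Lagrange.nodal s γ) = ∏ i ∈ s, (z - γ i) := by
  simp [Lagrange.nodal, map_prod]

/-- Multiplying by the conjugates of both even products leaves a positive combination of two numbers
N · conj D, whose imaginary parts have the same sign, depending only on r. -/
theorem aeval_mix_ne_zero_of_im_pos {r : ℕ} {γ γ' : Fin r → ℝ} (hγ : StrictMono γ)
    (hγ' : StrictMono γ') {a b : ℝ} (ha : 0 < a) (hb : 0 < b) {z : ℂ} (hz : 0 < z.im) :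
    aeval z (C a * (oddProd γ * evenProd γ') + C b * (oddProd γ' * evenProd γ)) ≠ 0 := by
  simp only [map_add, map_mul, aeval_C, oddProd, evenProd, aeval_nodal, Complex.coe_algebraMap]
  cases r with
  | zero =>
    simp only [Finset.prod_of_isEmpty, mul_one]
    exact_mod_cast (add_pos ha hb).ne'
  | succ r =>
    have h1 := (alternating_im_pos hz r γ hγ).1
    have h2 := (alternating_im_pos hz r γ' hγ').1
    set N := ∏ i ∈ oddNodes (r + 1), (z - γ i)
    set D := ∏ i ∈ evenNodes (r + 1), (z - γ i)
    set N' := ∏ i ∈ oddNodes (r + 1), (z - γ' i)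
    set D' := ∏ i ∈ evenNodes (r + 1), (z - γ' i)
    intro h0
    have hD : 0 < Complex.normSq D := by
      rw [Complex.normSq_pos]; intro hD; simp [hD] at h1
    have hD' : 0 < Complex.normSq D' := by
      rw [Complex.normSq_pos]; intro hD'; simp [hD'] at h2
    have key : ((a * Complex.normSq D' : ℝ) : ℂ) * (N * (starRingEnd ℂ) D) +
        ((b * Complex.normSq D : ℝ) : ℂ) * (N' * (starRingEnd ℂ) D') = 0 := by
      push_cast
      rw [← Complex.mul_conj, ← Complex.mul_conj]
      linear_combination ((starRingEnd ℂ) D * (starRingEnd ℂ) D') * h0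
    have him := congrArg Complex.im key
    rw [Complex.add_im, Complex.im_ofReal_mul, Complex.im_ofReal_mul, Complex.zero_im] at him
    have h3 := mul_pos (mul_pos ha hD') h1
    have h4 := mul_pos (mul_pos hb hD) h2
    have : (-1 : ℝ) ^ r * (a * Complex.normSq D' * (N * (starRingEnd ℂ) D).im +
      b * Complex.normSq D * (N' * (starRingEnd ℂ) D').im) = 0 := by rw [him, mul_zero]
    linarith

theorem aeval_mix_ne_zero_of_im_ne_zero {r : ℕ} {γ γ' : Fin r → ℝ} (hγ : StrictMono γ)
    (hγ' : StrictMono γ') {a b : ℝ} (ha : 0 < a) (hb : 0 < b) {z : ℂ} (hz : z.im ≠ 0) :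
    aeval z (C a * (oddProd γ * evenProd γ') + C b * (oddProd γ' * evenProd γ)) ≠ 0 := by
  rcases hz.lt_or_gt with hz | hz
  · intro h0
    have := aeval_mix_ne_zero_of_im_pos hγ hγ' ha hb (z := (starRingEnd ℂ) z) (by simpa using hz)
    rw [Polynomial.aeval_conj, h0] at this
    simp at this
  · exact aeval_mix_ne_zero_of_im_pos hγ hγ' ha hb hz

/-- A point outside an order-connected set has the whole set on one side, so corresponding factors
have equal signs. -/
theorem eval_nodal_mul_eval_nodal_pos {ι : Type*} {s : Finset ι} {T : Set ℝ}
    (hT : T.OrdConnected) {γ γ' : ι → ℝ} (h : ∀ i, γ i ∈ T) (h' : ∀ i, γ' i ∈ T) {x : ℝ}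
    (hx : x ∉ T) : 0 < (Lagrange.nodal s γ).eval x * (Lagrange.nodal s γ').eval x := by
  rw [Lagrange.eval_nodal, Lagrange.eval_nodal, ← Finset.prod_mul_distrib]
  refine Finset.prod_pos fun i _ => ?_
  rcases lt_trichotomy x (γ i) with h1 | h1 | h1
  · rcases lt_or_ge x (γ' i) with h2 | h2
    · exact mul_pos_of_neg_of_neg (by linarith) (by linarith)
    · exact absurd (hT.out (h' i) (h i) ⟨h2, h1.le⟩) hx
  · exact absurd (h1 ▸ h i) hx
  · rcases lt_or_ge (γ' i) x with h2 | h2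
    · exact mul_pos (by linarith) (by linarith)
    · exact absurd (hT.out (h i) (h' i) ⟨h1.le, h2⟩) hx

theorem eval_mix_ne_zero {r : ℕ} {T : Set ℝ} (hT : T.OrdConnected) {γ γ' : Fin r → ℝ}
    (hγ : ∀ i, γ i ∈ T) (hγ' : ∀ i, γ' i ∈ T) {a b : ℝ} (ha : 0 < a) (hb : 0 < b) {x : ℝ}
    (hx : x ∉ T) :
    (C a * (oddProd γ * evenProd γ') + C b * (oddProd γ' * evenProd γ)).eval x ≠ 0 := by
  have h1 := eval_nodal_mul_eval_nodal_pos (s := oddNodes r) hT hγ hγ' hx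
  have h2 := eval_nodal_mul_eval_nodal_pos (s := evenNodes r) hT hγ hγ' hx
  simp only [eval_add, eval_mul, eval_C]
  change 0 < (oddProd γ).eval x * (oddProd γ').eval x at h1
  change 0 < (evenProd γ).eval x * (evenProd γ').eval x at h2
  intro h0
  have h3 : 0 < (a * ((oddProd γ).eval x * (evenProd γ').eval x)) *
      (b * ((oddProd γ').eval x * (evenProd γ).eval x)) := by
    have := mul_pos (mul_pos ha hb) (mul_pos h1 h2)
    linarith
  rw [eq_neg_of_add_eq_zero_right h0] at h3
  nlinarith [sq_nonneg (a * ((oddProd γ).eval x * (evenProd γ').eval x))]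

/-- There is no common complex zero: on T the polynomial f is positive, and elsewhere the mixed
polynomial does not vanish. -/
theorem isCoprime_mix {r : ℕ} {T : Set ℝ} (hT : T.OrdConnected) {γ γ' : Fin r → ℝ}
    (hγ : γ ∈ Simplex r T) (hγ' : γ' ∈ Simplex r T) {a b : ℝ} (ha : 0 < a) (hb : 0 < b)
    {f : ℝ[X]} (hf : ∀ t ∈ T, 0 < f.eval t) :
    IsCoprime f (C a * (oddProd γ * evenProd γ') + C b * (oddProd γ' * evenProd γ)) := by
  refine (Polynomial.isCoprime_iff_aeval_ne_zero_of_isAlgClosed ℝ ℂ _ _).2 fun z => ?_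
  by_cases hz : z.im = 0
  · obtain ⟨x, rfl⟩ : ∃ x : ℝ, (x : ℂ) = z := ⟨z.re, Complex.ext rfl (by simp [hz])⟩
    have hev : ∀ p : ℝ[X], aeval (x : ℂ) p = ((p.eval x : ℝ) : ℂ) := fun p =>
      Polynomial.aeval_algebraMap_apply_eq_algebraMap_eval x p
    rw [hev, hev, Complex.ofReal_ne_zero, Complex.ofReal_ne_zero]
    by_cases hx : x ∈ T
    · exact Or.inl (hf x hx).ne'
    · exact Or.inr (eval_mix_ne_zero hT (fun i => interior_subset (hγ.1 i))
        (fun i => interior_subset (hγ'.1 i)) ha hb hx)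
  · exact Or.inr (aeval_mix_ne_zero_of_im_ne_zero hγ.2 hγ'.2 ha hb hz)

/-- Both products are monic of degree r and the weights are positive, so the top coefficients cannot
cancel. This bounds the degree from below in the uniqueness proof. -/
theorem coeff_mix_ne_zero {r : ℕ} (γ γ' : Fin r → ℝ) {a b : ℝ} (ha : 0 < a) (hb : 0 < b) :
    (C a * (oddProd γ * evenProd γ') + C b * (oddProd γ' * evenProd γ)).coeff r ≠ 0 := by
  have hd : ∀ γ γ' : Fin r → ℝ, (oddProd γ * evenProd γ').coeff r = 1 := by
    intro γ γ'
    have h1 := (oddProd_monic γ).mul (evenProd_monic γ')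
    have h2 : (oddProd γ * evenProd γ').natDegree = r := by
      rw [(oddProd_monic γ).natDegree_mul (evenProd_monic γ'), natDegree_oddProd,
        natDegree_evenProd]
      omega
    rw [Monic, leadingCoeff, h2] at h1
    exact h1
  rw [coeff_add, coeff_C_mul, coeff_C_mul, hd, hd]
  linarith

/-! ### Uniqueness of the representation -/

/-- Two representations of a polynomial that is positive on `T` have proportional products. -/
theorem Admissible.cross_mul_eq {r : ℕ} {T : Set ℝ} {u v : ℝ[X]} (h : Admissible r T u v)
    {γ γ' : Fin r → ℝ} (hγ : γ ∈ Simplex r T) (hγ' : γ' ∈ Simplex r T) {a b a' b' : ℝ}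
    (ha : 0 < a) (hb : 0 < b) (ha' : 0 < a') (hb' : 0 < b') {f : ℝ[X]}
    (hf : ∀ t ∈ T, 0 < f.eval t)
    (e : f = u * (C a * oddProd γ) ^ 2 + v * (C b * evenProd γ) ^ 2)
    (e' : f = u * (C a' * oddProd γ') ^ 2 + v * (C b' * evenProd γ') ^ 2) :
    C a * C b' * (oddProd γ * evenProd γ') = C a' * C b * (oddProd γ' * evenProd γ) := by
  have hab' := mul_pos ha hb'
  have hab := mul_pos ha' hb
  have hHr := coeff_mix_ne_zero γ γ' hab' hab
  have hcop := isCoprime_mix h.ordConnected hγ hγ' hab' hab hf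
  simp only [C_mul] at hHr hcop
  set H := C a * C b' * (oddProd γ * evenProd γ') + C a' * C b * (oddProd γ' * evenProd γ)
    with hH
  obtain ⟨G, hG⟩ : ∃ G, G = C a * C b' * (oddProd γ * evenProd γ') -
    C a' * C b * (oddProd γ' * evenProd γ) := ⟨_, rfl⟩
  -- Eliminating v, and next u, from the two representations leaves a difference of squares, which
  -- factors as G H.
  have e1 : u * G * H = f * ((C b' * evenProd γ') ^ 2 - (C b * evenProd γ) ^ 2) := by
    rw [hG, hH]
    linear_combination (C b * evenProd γ) ^ 2 * e' - (C b' * evenProd γ') ^ 2 * e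
  have e2 : v * G * H = f * ((C a * oddProd γ) ^ 2 - (C a' * oddProd γ') ^ 2) := by
    rw [hG, hH]
    linear_combination (C a' * oddProd γ') ^ 2 * e - (C a * oddProd γ) ^ 2 * e'
  have hfu : IsCoprime f u := by
    have h1 : IsCoprime (v * (C b * evenProd γ) ^ 2) u := by
      refine IsCoprime.mul_left h.isCoprime.symm (IsCoprime.pow_left (IsCoprime.mul_left ?_ ?_))
      · exact (isCoprime_one_left (x := u)).of_isCoprime_of_dvd_left (isUnit_C.2 hb.ne'.isUnit).dvd
      · exact isCoprime_nodal fun i _ => (h.u_pos _ (hγ.1 i)).ne'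
    rw [e, add_comm]
    exact IsCoprime.add_mul_left_left h1 _
  obtain ⟨k, hk⟩ : f ∣ G := by
    refine hfu.dvd_of_dvd_mul_left (hcop.dvd_of_dvd_mul_right ⟨_, e1⟩)
  obtain ⟨t₀, ht₀⟩ := h.nonempty_interior
  have hf0 : f ≠ 0 := by
    rintro rfl
    simpa using hf t₀ (interior_subset ht₀)
  have hu0 : u ≠ 0 := by
    rintro rfl
    simpa using h.u_pos t₀ ht₀
  have hv0 : v ≠ 0 := by
    rintro rfl
    simpa using h.v_pos t₀ ht₀
  have hH00 : H ≠ 0 := by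
    intro h0
    rw [h0] at hHr
    exact hHr (coeff_zero r)
  have hH0 := le_natDegree_of_ne_zero hHr
  -- After cancelling f, a nonzero k would give the left side degree at least r + 1 against a bound
  -- r (r even), or at least r against r - 1 (r odd).
  have hk0 : k = 0 := by
    by_contra hk0
    rcases Nat.even_or_odd r with hr | hr
    · have e3 : v * k * H = (C a * oddProd γ) ^ 2 - (C a' * oddProd γ') ^ 2 := by
        apply mul_left_cancel₀ hf0
        rw [← e2, hk]; ring
      have h4 : (v * k * H).natDegree ≤ 2 * ((r + 1) / 2) := by
        rw [e3]
        refine (natDegree_sub_le _ _).trans (max_le ?_ ?_) <;>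
        · rw [natDegree_pow]
          exact Nat.mul_le_mul_left 2 ((natDegree_C_mul_le _ _).trans (natDegree_oddProd _).le)
      rw [natDegree_mul (mul_ne_zero hv0 hk0) hH00, natDegree_mul hv0 hk0,
        h.odd_or.resolve_left (Nat.not_odd_iff_even.2 hr)] at h4
      obtain ⟨m, rfl⟩ := hr
      omega
    · have e3 : u * k * H = (C b' * evenProd γ') ^ 2 - (C b * evenProd γ) ^ 2 := by
        apply mul_left_cancel₀ hf0
        rw [← e1, hk]; ring
      have h4 : (u * k * H).natDegree ≤ 2 * (r / 2) := by
        rw [e3]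
        refine (natDegree_sub_le _ _).trans (max_le ?_ ?_) <;>
        · rw [natDegree_pow]
          exact Nat.mul_le_mul_left 2 ((natDegree_C_mul_le _ _).trans (natDegree_evenProd _).le)
      rw [natDegree_mul (mul_ne_zero hu0 hk0) hH00] at h4
      obtain ⟨m, rfl⟩ := hr
      omega
  rw [hk0, mul_zero, hG] at hk
  exact sub_eq_zero.1 hk

theorem exists_eq_of_eval_nodal_eq_zero {ι : Type*} {s : Finset ι} {γ : ι → ℝ} {t : ℝ}
    (h : (Lagrange.nodal s γ).eval t = 0) : ∃ i ∈ s, γ i = t := by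
  by_contra! hne
  exact Lagrange.eval_nodal_not_at_node (fun i hi => (hne i hi).symm) h

theorem mem_oddNodes_or_mem_evenNodes {r : ℕ} (i : Fin r) : i ∈ oddNodes r ∨ i ∈ evenNodes r := by
  simpa using Nat.even_or_odd i.val

theorem range_subset_of_sq_eq {r : ℕ} {γ γ' : Fin r → ℝ}
    (hP : oddProd γ ^ 2 = oddProd γ' ^ 2) (hQ : evenProd γ ^ 2 = evenProd γ' ^ 2) :
    range γ ⊆ range γ' := by
  rintro _ ⟨i, rfl⟩
  rcases mem_oddNodes_or_mem_evenNodes i with hi | hi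
  · have h1 := congrArg (eval (γ i)) hP
    rw [eval_pow, eval_pow, oddProd, Lagrange.eval_nodal_at_node hi, zero_pow two_ne_zero] at h1
    obtain ⟨j, _, hj⟩ := exists_eq_of_eval_nodal_eq_zero (pow_eq_zero_iff two_ne_zero |>.1 h1.symm)
    exact ⟨j, hj⟩
  · have h1 := congrArg (eval (γ i)) hQ
    rw [eval_pow, eval_pow, evenProd, Lagrange.eval_nodal_at_node hi, zero_pow two_ne_zero] at h1
    obtain ⟨j, _, hj⟩ := exists_eq_of_eval_nodal_eq_zero (pow_eq_zero_iff two_ne_zero |>.1 h1.symm)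
    exact ⟨j, hj⟩

theorem Admissible.u_ne_zero {r : ℕ} {T : Set ℝ} {u v : ℝ[X]} (h : Admissible r T u v) :
    u ≠ 0 := by
  rintro rfl
  obtain ⟨t, ht⟩ := h.nonempty_interior
  simpa using h.u_pos t ht

theorem Admissible.v_ne_zero {r : ℕ} {T : Set ℝ} {u v : ℝ[X]} (h : Admissible r T u v) :
    v ≠ 0 := by
  rintro rfl
  obtain ⟨t, ht⟩ := h.nonempty_interior
  simpa using h.v_pos t ht

theorem eq_of_C_mul_monic_eq {p q : ℝ[X]} (hp : p.Monic) (hq : q.Monic) {a b : ℝ} (hb : b ≠ 0)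
    (h : C a * p = C b * q) : a = b ∧ p = q := by
  have h1 : a = b := by
    have := congrArg leadingCoeff h
    rwa [leadingCoeff_mul, leadingCoeff_mul, leadingCoeff_C, leadingCoeff_C, hp.leadingCoeff,
      hq.leadingCoeff, mul_one, mul_one] at this
  subst h1
  exact ⟨rfl, mul_left_cancel₀ (C_ne_zero.2 hb) h⟩

/-- The representation of a polynomial by `weightedPoly` is unique. -/
theorem Admissible.injOn_weightedPoly {r : ℕ} {T : Set ℝ} {u v : ℝ[X]}
    (h : Admissible r T u v) :
    InjOn (weightedPoly (r := r) u v) ((Ioi (0 : ℝ) ×ˢ Ioi (0 : ℝ)) ×ˢ Simplex r T) := by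
  rintro x hx x' hx' hxx'
  rw [mem_paramDomain] at hx hx'
  obtain ⟨h1, h2, hγ⟩ := hx
  obtain ⟨h1', h2', hγ'⟩ := hx'
  have hf : ∀ t ∈ T, 0 < (weightedPoly u v x).eval t := fun t ht =>
    h.eval_weightedPoly_pos h1 h2 hγ ht
  have hsq : ∀ {c : ℝ}, 0 < c → (C c : ℝ[X]) = C (√c) ^ 2 := fun hc => by
    rw [← C_pow, Real.sq_sqrt hc.le]
  have e : ∀ {y : (ℝ × ℝ) × (Fin r → ℝ)}, 0 < y.1.1 → 0 < y.1.2 → weightedPoly u v y =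
      u * (C (√y.1.1) * oddProd y.2) ^ 2 + v * (C (√y.1.2) * evenProd y.2) ^ 2 := fun hy hy' => by
    rw [weightedPoly, mul_pow, mul_pow, ← hsq hy, ← hsq hy']; ring
  have key := h.cross_mul_eq hγ hγ' (Real.sqrt_pos.2 h1) (Real.sqrt_pos.2 h2)
    (Real.sqrt_pos.2 h1') (Real.sqrt_pos.2 h2') hf (e h1 h2) (hxx'.trans (e h1' h2'))
  set U := C x.1.1 * u * oddProd x.2 ^ 2 with hU
  set V := C x.1.2 * v * evenProd x.2 ^ 2 with hV
  set U' := C x'.1.1 * u * oddProd x'.2 ^ 2 with hU'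
  set V' := C x'.1.2 * v * evenProd x'.2 ^ 2 with hV'
  have hsum : U + V = U' + V' := hxx'
  have hcross : U * V' = U' * V := by
    rw [hU, hV, hU', hV', hsq h1, hsq h2, hsq h1', hsq h2']
    linear_combination (u * v * (C (√x.1.1) * C (√x'.1.2) * (oddProd x.2 * evenProd x'.2) +
      C (√x'.1.1) * C (√x.1.2) * (oddProd x'.2 * evenProd x.2))) * key
  have hf0 : U + V ≠ 0 := by
    obtain ⟨t, ht⟩ := h.nonempty_interior
    intro h0
    have := hf t (interior_subset ht)
    rw [weightedPoly, h0] at this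
    simp at this
  -- Equal sums and U V' = U' V give U (U + V) = U' (U + V).
  have hUU : U = U' := by
    apply mul_right_cancel₀ hf0
    linear_combination U * hsum + hcross
  have hVV : V = V' := by
    rw [hUU] at hsum
    exact add_left_cancel hsum
  have hP : C x.1.1 * oddProd x.2 ^ 2 = C x'.1.1 * oddProd x'.2 ^ 2 := by
    apply mul_left_cancel₀ h.u_ne_zero
    linear_combination hUU
  have hQ : C x.1.2 * evenProd x.2 ^ 2 = C x'.1.2 * evenProd x'.2 ^ 2 := by
    apply mul_left_cancel₀ h.v_ne_zero
    linear_combination hVV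
  obtain ⟨hα, hP⟩ := eq_of_C_mul_monic_eq ((oddProd_monic _).pow 2) ((oddProd_monic _).pow 2)
    h1'.ne' hP
  obtain ⟨hβ, hQ⟩ := eq_of_C_mul_monic_eq ((evenProd_monic _).pow 2) ((evenProd_monic _).pow 2)
    h2'.ne' hQ
  have hrange : range x.2 = range x'.2 :=
    (range_subset_of_sq_eq hP hQ).antisymm (range_subset_of_sq_eq hP.symm hQ.symm)
  exact Prod.ext (Prod.ext hα hβ) ((hγ.2.range_inj hγ'.2).1 hrange)

/-! ### Coefficient vectors and their smoothness -/

theorem sum_coeffVec {n : ℕ} {p : ℝ[X]} (hp : p.natDegree ≤ n) (t : ℝ) :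
    ∑ i : Fin (n + 1), coeffVec n p i * t ^ (i : ℕ) = p.eval t := by
  rw [eval_eq_sum_range' (Nat.lt_succ_of_le hp), ← Fin.sum_univ_eq_sum_range
    (fun i => p.coeff i * t ^ i)]
  rfl

theorem coeffVec_injective {n : ℕ} {p q : ℝ[X]} (hp : p.natDegree ≤ n) (hq : q.natDegree ≤ n)
    (h : coeffVec n p = coeffVec n q) : p = q :=
  Polynomial.funext fun t => by rw [← sum_coeffVec hp, ← sum_coeffVec hq, h]

theorem contDiff_coeff_mul {E : Type*} [NormedAddCommGroup E] [NormedSpace ℝ E] {f g : E → ℝ[X]}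
    (hf : ∀ k, ContDiff ℝ ∞ fun x => (f x).coeff k)
    (hg : ∀ k, ContDiff ℝ ∞ fun x => (g x).coeff k) (k : ℕ) :
    ContDiff ℝ ∞ fun x => (f x * g x).coeff k := by
  simp only [coeff_mul]
  exact ContDiff.sum fun i _ => (hf _).mul (hg _)

theorem contDiff_coeff_nodal {r : ℕ} (s : Finset (Fin r)) (k : ℕ) :
    ContDiff ℝ ∞ fun γ : Fin r → ℝ => (Lagrange.nodal s γ).coeff k := by
  induction s using Finset.induction_on generalizing k with
  | empty => simpa using contDiff_const
  | insert i s hi ih =>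
    simp only [Lagrange.nodal_insert_eq_nodal hi]
    refine contDiff_coeff_mul (fun k => ?_) ih k
    simp only [coeff_sub, coeff_C]
    split_ifs <;> fun_prop

theorem contDiff_coeffVec_weightedPoly {r : ℕ} (n : ℕ) (u v : ℝ[X]) :
    ContDiff ℝ ∞ fun x : (ℝ × ℝ) × (Fin r → ℝ) => coeffVec n (weightedPoly u v x) := by
  have hC : ∀ {g : (ℝ × ℝ) × (Fin r → ℝ) → ℝ}, ContDiff ℝ ∞ g → ∀ k, ContDiff ℝ ∞ fun x =>
      (C (g x)).coeff k := fun hg k => by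
    simp only [coeff_C]
    split_ifs <;> fun_prop
  have hN : ∀ s : Finset (Fin r), ∀ k, ContDiff ℝ ∞ fun x : (ℝ × ℝ) × (Fin r → ℝ) =>
      (Lagrange.nodal s x.2).coeff k := fun s k => (contDiff_coeff_nodal s k).comp contDiff_snd
  rw [contDiff_pi]
  intro i
  simp only [coeffVec, weightedPoly, coeff_add, sq]
  refine ContDiff.add ?_ ?_
  · refine contDiff_coeff_mul (contDiff_coeff_mul (hC (by fun_prop)) fun _ => contDiff_const)
      (contDiff_coeff_mul (hN _) (hN _)) _
  · refine contDiff_coeff_mul (contDiff_coeff_mul (hC (by fun_prop)) fun _ => contDiff_const)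
      (contDiff_coeff_mul (hN _) (hN _)) _

/-! ### Injectivity of the derivative -/

/-- The derivative of `∏ (X - γ i)` in the direction `w` of the nodes. -/
def nodalVariation {r : ℕ} (s : Finset (Fin r)) (γ w : Fin r → ℝ) : ℝ[X] :=
  ∑ i ∈ s, C (-w i) * Lagrange.nodal (s.erase i) γ

theorem natDegree_nodalVariation_le {r : ℕ} (s : Finset (Fin r)) (γ w : Fin r → ℝ) :
    (nodalVariation s γ w).natDegree ≤ s.card := by
  refine natDegree_sum_le_of_forall_le _ _ fun i hi => (natDegree_C_mul_le _ _).trans ?_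
  rw [Lagrange.natDegree_nodal]
  exact Finset.card_erase_le

theorem eval_nodalVariation {r : ℕ} {s : Finset (Fin r)} {i : Fin r} (hi : i ∈ s)
    (γ w : Fin r → ℝ) : (nodalVariation s γ w).eval (γ i) =
      -w i * (Lagrange.nodal (s.erase i) γ).eval (γ i) := by
  rw [nodalVariation, eval_finsetSum, Finset.sum_eq_single_of_mem i hi]
  · simp
  · intro j _ hj
    rw [eval_mul, Lagrange.eval_nodal_at_node (Finset.mem_erase.2 ⟨hj.symm, hi⟩), mul_zero]

theorem hasDerivAt_eval_nodal {r : ℕ} (s : Finset (Fin r)) (γ w : Fin r → ℝ) (t : ℝ) :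
    HasDerivAt (fun τ : ℝ => (Lagrange.nodal s (γ + τ • w)).eval t)
      ((nodalVariation s γ w).eval t) 0 := by
  simp only [Lagrange.eval_nodal]
  have h : ∀ i ∈ s, HasDerivAt (fun τ : ℝ => t - (γ + τ • w) i) (-w i) 0 := fun i _ => by
    simpa using (((hasDerivAt_id (0 : ℝ)).mul_const (w i)).const_add (γ i)).const_sub t
  refine (HasDerivAt.fun_finsetProd h).congr_deriv ?_
  simp [nodalVariation, eval_finsetSum, Lagrange.eval_nodal, mul_comm]

/-- At the node `γ i` every summand vanishes except the one carrying `w i`. -/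
theorem variation_eq_zero {r : ℕ} {s : Finset (Fin r)} {γ w : Fin r → ℝ}
    (hγ : Function.Injective γ) {α dα : ℝ} (hα : α ≠ 0)
    (h : C dα * Lagrange.nodal s γ + C (2 * α) * nodalVariation s γ w = 0) :
    dα = 0 ∧ ∀ i ∈ s, w i = 0 := by
  have hw : ∀ i ∈ s, w i = 0 := by
    intro i hi
    have h1 := congrArg (eval (γ i)) h
    rw [eval_add, eval_mul, eval_mul, Lagrange.eval_nodal_at_node hi, eval_nodalVariation hi] at h1
    have h2 : (Lagrange.nodal (s.erase i) γ).eval (γ i) ≠ 0 :=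
      Lagrange.eval_nodal_not_at_node fun j hj hij => Finset.ne_of_mem_erase hj (hγ hij).symm
    simpa [hα, h2] using h1
  refine ⟨?_, hw⟩
  have h0 : nodalVariation s γ w = 0 :=
    Finset.sum_eq_zero fun i hi => by simp [hw i hi]
  rw [h0, mul_zero, add_zero] at h
  simpa [Lagrange.nodal_ne_zero] using h

/-- By coprimality v Q divides R and u P divides S. For even r the first divisor has degree
exceeding the bound on R, for odd r the second exceeds the bound on S. -/
theorem Admissible.variation_eq_zero {r : ℕ} {T : Set ℝ} {u v : ℝ[X]} (h : Admissible r T u v)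
    {γ : Fin r → ℝ} (hγ : γ ∈ Simplex r T) {R S : ℝ[X]} (hR : R.natDegree ≤ (r + 1) / 2)
    (hS : S.natDegree ≤ r / 2) (e : u * oddProd γ * R + v * evenProd γ * S = 0) :
    R = 0 ∧ S = 0 := by
  have hcop := h.isCoprime_mul hγ
  have hP0 : u * oddProd γ ≠ 0 := mul_ne_zero h.u_ne_zero (oddProd_monic γ).ne_zero
  have hQ0 : v * evenProd γ ≠ 0 := mul_ne_zero h.v_ne_zero (evenProd_monic γ).ne_zero
  have hd1 : v * evenProd γ ∣ R := hcop.symm.dvd_of_dvd_mul_left ⟨-S, by linear_combination e⟩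
  have hd2 : u * oddProd γ ∣ S := hcop.dvd_of_dvd_mul_left ⟨-R, by linear_combination e⟩
  rcases Nat.even_or_odd r with hr | hr
  · have hR0 : R = 0 := by
      by_contra h0
      have := natDegree_le_of_dvd hd1 h0
      rw [natDegree_mul h.v_ne_zero (evenProd_monic γ).ne_zero, natDegree_evenProd,
        h.odd_or.resolve_left (Nat.not_odd_iff_even.2 hr)] at this
      obtain ⟨m, rfl⟩ := hr
      omega
    rw [hR0, mul_zero, zero_add, mul_eq_zero] at e
    exact ⟨hR0, e.resolve_left hQ0⟩
  · have hS0 : S = 0 := by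
      by_contra h0
      have := natDegree_le_of_dvd hd2 h0
      rw [natDegree_mul h.u_ne_zero (oddProd_monic γ).ne_zero, natDegree_oddProd] at this
      obtain ⟨m, rfl⟩ := hr
      omega
    rw [hS0, mul_zero, add_zero, mul_eq_zero] at e
    exact ⟨e.resolve_left hP0, hS0⟩

/-- The coefficient map has an injective derivative on the parameter domain. -/
theorem Admissible.fderiv_injective {r : ℕ} {T : Set ℝ} {u v : ℝ[X]} (h : Admissible r T u v)
    {x : (ℝ × ℝ) × (Fin r → ℝ)} (hx : x ∈ (Ioi (0 : ℝ) ×ˢ Ioi (0 : ℝ)) ×ˢ Simplex r T) :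
    Function.Injective (fderiv ℝ (fun x : (ℝ × ℝ) × (Fin r → ℝ) =>
      coeffVec (r + 1) (weightedPoly u v x)) x) := by
  rw [mem_paramDomain] at hx
  obtain ⟨h1, h2, hγ⟩ := hx
  set φ := fun x : (ℝ × ℝ) × (Fin r → ℝ) => coeffVec (r + 1) (weightedPoly u v x) with hφ
  rw [injective_iff_map_eq_zero]
  intro w hw
  have hdφ : HasDerivAt (fun τ : ℝ => φ (x + τ • w)) 0 0 := by
    have hd : HasFDerivAt φ (fderiv ℝ φ x) (x + (0 : ℝ) • w) := by
      rw [zero_smul, add_zero]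
      exact ((contDiff_coeffVec_weightedPoly (r + 1) u v).differentiable (by simp) x).hasFDerivAt
    have hl : HasDerivAt (fun τ : ℝ => x + τ • w) w 0 := by
      simpa using ((hasDerivAt_id (0 : ℝ)).smul_const w).const_add x
    have := hd.comp_hasDerivAt 0 hl
    rwa [hw] at this
  have hev : ∀ t : ℝ, HasDerivAt (fun τ : ℝ => (weightedPoly u v (x + τ • w)).eval t) 0 0 := by
    intro t
    have h3 := HasDerivAt.fun_sum (u := Finset.univ) fun (i : Fin (r + 2)) _ =>
      ((hasDerivAt_pi.1 hdφ) i).mul_const (t ^ (i : ℕ))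
    simp only [hφ, sum_coeffVec (natDegree_weightedPoly_le h _)] at h3
    simpa using h3
  set R := C w.1.1 * oddProd x.2 + C (2 * x.1.1) * nodalVariation (oddNodes r) x.2 w.2 with hR
  set S := C w.1.2 * evenProd x.2 + C (2 * x.1.2) * nodalVariation (evenNodes r) x.2 w.2 with hS
  -- The left side is the derivative of α u P² + β v Q² in the direction w, computed pointwise in t.
  have e : u * oddProd x.2 * R + v * evenProd x.2 * S = 0 := by
    refine Polynomial.funext fun t => ?_
    have hA : HasDerivAt (fun τ : ℝ => x.1.1 + τ * w.1.1) w.1.1 0 := by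
      simpa using ((hasDerivAt_id (0 : ℝ)).mul_const w.1.1).const_add x.1.1
    have hB : HasDerivAt (fun τ : ℝ => x.1.2 + τ * w.1.2) w.1.2 0 := by
      simpa using ((hasDerivAt_id (0 : ℝ)).mul_const w.1.2).const_add x.1.2
    have h3 := ((hA.mul_const (u.eval t)).mul
      ((hasDerivAt_eval_nodal (oddNodes r) x.2 w.2 t).pow 2)).add
      ((hB.mul_const (v.eval t)).mul ((hasDerivAt_eval_nodal (evenNodes r) x.2 w.2 t).pow 2))
    have h4 := (hev t).congr_of_eventuallyEq (f₁ := _) (Filter.Eventually.of_forall fun τ =>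
      (eval_weightedPoly u v (x + τ • w) t).symm) |>.unique h3
    simp only [hR, hS, oddProd, evenProd, eval_add, eval_mul, eval_C, eval_zero]
    simp at h4
    linarith
  obtain ⟨hR0, hS0⟩ := h.variation_eq_zero hγ (R := R) (S := S)
    (natDegree_add_le_of_degree_le
      ((natDegree_C_mul_le _ _).trans (natDegree_oddProd _).le)
      ((natDegree_C_mul_le _ _).trans
        ((natDegree_nodalVariation_le _ _ _).trans (card_oddNodes r).le)))
    (natDegree_add_le_of_degree_le
      ((natDegree_C_mul_le _ _).trans (natDegree_evenProd _).le)
      ((natDegree_C_mul_le _ _).trans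
        ((natDegree_nodalVariation_le _ _ _).trans (card_evenNodes r).le))) e
  obtain ⟨ha, hwo⟩ := PositivePolynomial.variation_eq_zero hγ.2.injective h1.ne' hR0
  obtain ⟨hb, hwe⟩ := PositivePolynomial.variation_eq_zero hγ.2.injective h2.ne' hS0
  refine Prod.ext (Prod.ext ha hb) (_root_.funext fun i => ?_)
  exact (mem_oddNodes_or_mem_evenNodes i).elim (hwo i) (hwe i)

/-! ### Inverse function theorem -/

open Filter Topology

/-- An injective smooth map between spaces of equal dimension whose derivative is injective is a
diffeomorphism onto its image. -/
theorem isDiffeoOn_image {E F : Type*} [NormedAddCommGroup E] [NormedSpace ℝ E]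
    [FiniteDimensional ℝ E] [NormedAddCommGroup F] [NormedSpace ℝ F] [FiniteDimensional ℝ F]
    (hdim : Module.finrank ℝ E = Module.finrank ℝ F) {f : E → F} {s : Set E} (hs : IsOpen s)
    (hf : ContDiff ℝ ∞ f) (hinj : InjOn f s)
    (hd : ∀ x ∈ s, Function.Injective (fderiv ℝ f x)) : IsDiffeoOn f s (f '' s) := by
  have : CompleteSpace E := FiniteDimensional.complete ℝ E
  have key : ∀ x ∈ s, ∃ g : F → E, ContDiffAt ℝ ∞ g (f x) ∧
      ∀ᶠ y in 𝓝 (f x), g y ∈ s ∧ f (g y) = y := by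
    intro x hx
    let e : E ≃L[ℝ] F := (LinearEquiv.ofInjectiveOfFinrankEq (fderiv ℝ f x : E →ₗ[ℝ] F)
      (hd x hx) hdim).toContinuousLinearEquiv
    have he : HasFDerivAt f (e : E →L[ℝ] F) x := by
      have : (e : E →L[ℝ] F) = fderiv ℝ f x := by ext; rfl
      rw [this]
      exact (hf.differentiable (by simp) x).hasFDerivAt
    have hn : (∞ : WithTop ℕ∞) ≠ 0 := by simp
    have hg : ContDiffAt ℝ ∞ (hf.contDiffAt.localInverse he hn) (f x) :=
      hf.contDiffAt.to_localInverse he hn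
    refine ⟨_, hg, ?_⟩
    refine Eventually.and ?_ (HasStrictFDerivAt.eventually_right_inverse _)
    refine hg.continuousAt.eventually_mem ?_
    rw [hf.contDiffAt.localInverse_apply_image he hn]
    exact hs.mem_nhds hx
  have hopen : IsOpen (f '' s) := by
    rw [isOpen_iff_mem_nhds]
    rintro _ ⟨x, hx, rfl⟩
    obtain ⟨g, _, hg⟩ := key x hx
    filter_upwards [hg] with y hy using ⟨g y, hy⟩
  refine ⟨hs, hopen, hinj.bijOn_image, hf.contDiffOn, Function.invFunOn f s,
    hinj.leftInvOn_invFunOn, ?_⟩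
  rintro _ ⟨x, hx, rfl⟩
  obtain ⟨g, hg, hgs⟩ := key x hx
  -- By injectivity the global inverse agrees near `f x` with the smooth local one, which takes
  -- values in s there.
  refine (hg.congr_of_eventuallyEq ?_).contDiffWithinAt
  filter_upwards [hgs] with y hy
  nth_rw 1 [← hy.2]
  exact hinj.leftInvOn_invFunOn hy.1

theorem isOpen_simplex (r : ℕ) (T : Set ℝ) : IsOpen (Simplex r T) := by
  have : Simplex r T = (⋂ i, {γ | γ i ∈ interior T}) ∩ ⋂ i, ⋂ j, {γ | i < j → γ i < γ j} := by
    ext γ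
    simp [Simplex, StrictMono]
  rw [this]
  refine (isOpen_iInter_of_finite fun i => isOpen_interior.preimage (continuous_apply i)).inter
    (isOpen_iInter_of_finite fun i => isOpen_iInter_of_finite fun j => ?_)
  by_cases hij : i < j
  · simpa [hij] using isOpen_lt (continuous_apply i) (continuous_apply j)
  · simp [hij]

theorem isOpen_paramDomain (n : ℕ) (T : Set ℝ) : IsOpen (paramDomain n T) :=
  (isOpen_Ioi.prod isOpen_Ioi).prod (isOpen_simplex _ T)

theorem Admissible.isDiffeoOn {r : ℕ} {T : Set ℝ} {u v : ℝ[X]} (h : Admissible r T u v) :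
    IsDiffeoOn (fun x : (ℝ × ℝ) × (Fin r → ℝ) => coeffVec (r + 1) (weightedPoly u v x))
      (paramDomain (r + 1) T)
      ((fun x => coeffVec (r + 1) (weightedPoly u v x)) '' paramDomain (r + 1) T) := by
  refine isDiffeoOn_image ?_ (isOpen_paramDomain (r + 1) T)
    (contDiff_coeffVec_weightedPoly (r + 1) u v) ?_ fun x hx => h.fderiv_injective hx
  · simp
    ring
  · intro x hx x' hx' hxx'
    exact h.injOn_weightedPoly hx hx' (coeffVec_injective (natDegree_weightedPoly_le h _)
      (natDegree_weightedPoly_le h _) hxx')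

/-! ### The cone and its strictly positive part -/

/-- The coefficient vectors of the polynomials that are positive on `T` and, if `T` is unbounded,
have a positive coefficient of `t ^ n`. -/
def posCone (n : ℕ) (T : Set ℝ) : Set (Fin (n + 1) → ℝ) :=
  {c | (∀ t ∈ T, 0 < ∑ i : Fin (n + 1), c i * t ^ (i : ℕ)) ∧ (¬ BddAbove T → 0 < c (Fin.last n))}

theorem convex_cone (n : ℕ) (T : Set ℝ) : Convex ℝ (cone n T) := by
  intro c hc d hd a b ha hb _ t ht
  have h : ∑ i : Fin (n + 1), (a • c + b • d) i * t ^ (i : ℕ) =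
      a * ∑ i : Fin (n + 1), c i * t ^ (i : ℕ) + b * ∑ i : Fin (n + 1), d i * t ^ (i : ℕ) := by
    simp [add_mul, Finset.sum_add_distrib, Finset.mul_sum, mul_assoc]
  rw [h]
  exact add_nonneg (mul_nonneg ha (hc t ht)) (mul_nonneg hb (hd t ht))

theorem convex_posCone (n : ℕ) (T : Set ℝ) : Convex ℝ (posCone n T) := by
  have key : ∀ {a b x y : ℝ}, 0 ≤ a → 0 ≤ b → a + b = 1 → 0 < x → 0 < y → 0 < a * x + b * y := by
    intro a b x y ha hb hab hx hy
    rcases ha.eq_or_lt with rfl | ha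
    · rw [zero_add] at hab; subst hab; linarith
    · exact add_pos_of_pos_of_nonneg (mul_pos ha hx) (mul_nonneg hb hy.le)
  intro c hc d hd a b ha hb hab
  refine ⟨fun t ht => ?_, fun hT => key ha hb hab (hc.2 hT) (hd.2 hT)⟩
  have h : ∑ i : Fin (n + 1), (a • c + b • d) i * t ^ (i : ℕ) =
      a * ∑ i : Fin (n + 1), c i * t ^ (i : ℕ) + b * ∑ i : Fin (n + 1), d i * t ^ (i : ℕ) := by
    simp [add_mul, Finset.sum_add_distrib, Finset.mul_sum, mul_assoc]
  rw [h]
  exact key ha hb hab (hc.1 t ht) (hd.1 t ht)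

theorem posCone_subset_cone (n : ℕ) (T : Set ℝ) : posCone n T ⊆ cone n T :=
  fun _ hc t ht => (hc.1 t ht).le

/-- The value at `t`, divided by `t ^ n`, tends to the coefficient of `t ^ n`. -/
theorem tendsto_eval_div_pow (n : ℕ) (c : Fin (n + 1) → ℝ) :
    Tendsto (fun t : ℝ => (∑ i : Fin (n + 1), c i * t ^ (i : ℕ)) / t ^ n) atTop
      (𝓝 (c (Fin.last n))) := by
  simp only [Fin.sum_univ_castSucc, add_div, Finset.sum_div]
  have h1 : Tendsto (fun t : ℝ => ∑ i : Fin n, c i.castSucc * t ^ (i.castSucc : ℕ) / t ^ n) atTop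
      (𝓝 (∑ i : Fin n, c i.castSucc * 0)) := by
    refine tendsto_finsetSum _ fun i _ => ?_
    simp only [mul_div_assoc]
    exact (tendsto_pow_div_pow_atTop_zero i.2).const_mul _
  have h2 : Tendsto (fun t : ℝ => c (Fin.last n) * t ^ (Fin.last n : ℕ) / t ^ n) atTop
      (𝓝 (c (Fin.last n))) := by
    refine tendsto_const_nhds.congr' ?_
    filter_upwards [eventually_gt_atTop 0] with t ht
    rw [Fin.val_last, mul_div_assoc, div_self (pow_pos ht n).ne', mul_one]
  simpa using h1.add h2

theorem nonneg_coeff_of_mem_cone {n : ℕ} {T : Set ℝ} (hT : ¬ BddAbove T) {c : Fin (n + 1) → ℝ}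
    (hc : c ∈ cone n T) : 0 ≤ c (Fin.last n) := by
  refine ge_of_tendsto_of_frequently (tendsto_eval_div_pow n c) ?_
  rw [frequently_atTop]
  intro M
  rw [not_bddAbove_iff] at hT
  obtain ⟨t, ht, hMt⟩ := hT (max M 0)
  exact ⟨t, (le_max_left M 0).trans hMt.le,
    div_nonneg (hc t ht) (pow_nonneg ((le_max_right M 0).trans hMt.le) n)⟩

/-- From an interior point one can still subtract a small ε from the constant or the top coefficient
and stay in the cone. -/
theorem interior_cone_subset_posCone (n : ℕ) (T : Set ℝ) : interior (cone n T) ⊆ posCone n T := by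
  intro c hc
  have key : ∀ i : Fin (n + 1), ∃ ε : ℝ, 0 < ε ∧ c - ε • Pi.single i (1 : ℝ) ∈ cone n T := by
    intro i
    have hcont : Tendsto (fun ε : ℝ => c - ε • Pi.single (M := fun _ => ℝ) i (1 : ℝ)) (𝓝[>] 0)
        (𝓝 c) := by
      have : Continuous fun ε : ℝ => c - ε • Pi.single (M := fun _ => ℝ) i (1 : ℝ) := by fun_prop
      simpa using (this.tendsto 0).mono_left nhdsWithin_le_nhds
    obtain ⟨ε, hε, hpos⟩ := ((hcont.eventually_mem (mem_interior_iff_mem_nhds.1 hc)).and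
      self_mem_nhdsWithin).exists
    exact ⟨ε, hpos, hε⟩
  refine ⟨fun t ht => ?_, fun hT => ?_⟩
  · obtain ⟨ε, hε, h⟩ := key 0
    have := h t ht
    simp only [Pi.sub_apply, Pi.smul_apply, smul_eq_mul, sub_mul, Finset.sum_sub_distrib,
      Pi.single_apply, mul_ite, mul_one, mul_zero, ite_mul, zero_mul, Finset.sum_ite_eq',
      Finset.mem_univ, if_true, Fin.val_zero, pow_zero] at this
    linarith
  · obtain ⟨ε, hε, h⟩ := key (Fin.last n)
    have := nonneg_coeff_of_mem_cone hT h
    simp only [Pi.sub_apply, Pi.smul_apply, Pi.single_eq_same, smul_eq_mul, mul_one] at this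
    linarith

/-- The difference lies in the frontier of a convex set, which is a null set. -/
theorem cone_ae_eq_posCone (n : ℕ) (T : Set ℝ) : cone n T =ᵐ[volume] posCone n T := by
  refine EventuallyLE.antisymm ?_ (Eventually.of_forall (posCone_subset_cone n T))
  refine ae_le_set.2 (measure_mono_null ?_ ((convex_cone n T).addHaar_frontier volume))
  exact fun c hc => ⟨subset_closure hc.1, fun h => hc.2 (interior_cone_subset_posCone n T h)⟩

/-- Exactly one of P² and v Q² has degree r + 1, and it is monic; parity decides which. -/
theorem Admissible.coeff_weightedPoly {r : ℕ} {T : Set ℝ} {u v : ℝ[X]} (h : Admissible r T u v)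
    (hT : ¬ BddAbove T) (x : (ℝ × ℝ) × (Fin r → ℝ)) :
    (weightedPoly u v x).coeff (r + 1) = if Odd r then x.1.1 else x.1.2 := by
  have hv := h.natDegree_v_le hT
  rw [weightedPoly, h.u_eq_one hT, mul_one, mul_assoc, coeff_add, coeff_C_mul, coeff_C_mul]
  have hP := (oddProd_monic x.2).pow 2
  have hPd : (oddProd x.2 ^ 2).natDegree = 2 * ((r + 1) / 2) := by
    rw [natDegree_pow, natDegree_oddProd]
  have hQd : (evenProd x.2 ^ 2).natDegree = 2 * (r / 2) := by
    rw [natDegree_pow, natDegree_evenProd]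
  split_ifs with hr
  · rw [show r + 1 = (oddProd x.2 ^ 2).natDegree by rw [hPd]; obtain ⟨m, rfl⟩ := hr; omega,
      coeff_natDegree, hP.leadingCoeff, coeff_eq_zero_of_natDegree_lt, mul_zero, add_zero, mul_one]
    refine natDegree_mul_le.trans_lt ?_
    rw [hPd, hQd]
    obtain ⟨m, rfl⟩ := hr
    omega
  · have hr' := Nat.not_odd_iff_even.1 hr
    have hQ := (h.v_monic hT hr').mul ((evenProd_monic x.2).pow 2)
    have hd : (v * evenProd x.2 ^ 2).natDegree = r + 1 := by
      rw [natDegree_mul h.v_ne_zero ((evenProd_monic x.2).pow 2).ne_zero, hQd,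
        h.odd_or.resolve_left hr]
      obtain ⟨m, rfl⟩ := hr'
      omega
    rw [coeff_eq_zero_of_natDegree_lt (p := oddProd x.2 ^ 2), mul_zero, zero_add, ← hd,
      coeff_natDegree, hQ.leadingCoeff, mul_one]
    rw [hPd]
    obtain ⟨m, rfl⟩ := hr'
    omega

theorem Admissible.image_subset_posCone {r : ℕ} {T : Set ℝ} {u v : ℝ[X]}
    (h : Admissible r T u v) :
    (fun x : (ℝ × ℝ) × (Fin r → ℝ) => coeffVec (r + 1) (weightedPoly u v x)) ''
      paramDomain (r + 1) T ⊆ posCone (r + 1) T := by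
  rintro _ ⟨x, hx, rfl⟩
  obtain ⟨h1, h2, hγ⟩ := mem_paramDomain.1 hx
  refine ⟨fun t ht => ?_, fun hT => ?_⟩
  · rw [sum_coeffVec (natDegree_weightedPoly_le h x)]
    exact h.eval_weightedPoly_pos h1 h2 hγ ht
  · change 0 < (weightedPoly u v x).coeff (r + 1)
    rw [h.coeff_weightedPoly hT]
    split_ifs <;> assumption

/-! ### Boundedness of the parameters -/

theorem exists_progression {U : Set ℝ} (hU : IsOpen U) (hne : U.Nonempty) (N : ℕ) :
    ∃ s δ : ℝ, 0 < δ ∧ δ ≤ 1 ∧ ∀ k : ℕ, k ≤ N → s + k * δ ∈ U := by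
  obtain ⟨s, hs⟩ := hne
  obtain ⟨ε, hε, hball⟩ := Metric.isOpen_iff.1 hU s hs
  have hN : (0 : ℝ) < N + 1 := by positivity
  refine ⟨s, min (ε / (N + 1)) 1, lt_min (by positivity) one_pos, min_le_right _ _, fun k hk => ?_⟩
  refine hball ?_
  have hδ : 0 < min (ε / (N + 1)) 1 := lt_min (by positivity) one_pos
  rw [Metric.mem_ball, Real.dist_eq, add_sub_cancel_left, abs_of_nonneg (by positivity)]
  have hk' : (k : ℝ) < N + 1 := by exact_mod_cast Nat.lt_succ_of_le hk
  calc (k : ℝ) * min (ε / (N + 1)) 1 < (N + 1) * min (ε / (N + 1)) 1 :=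
        mul_lt_mul_of_pos_right hk' hδ
    _ ≤ (N + 1) * (ε / (N + 1)) := mul_le_mul_of_nonneg_left (min_le_left _ _) hN.le
    _ = ε := by field_simp

/-- Pigeonhole: each of the r nodes is closer than δ / 2 to at most one of r + 1 points with spacing
δ. -/
theorem exists_far {r : ℕ} (γ : Fin r → ℝ) (s : ℝ) {δ : ℝ} (hδ : 0 < δ) :
    ∃ k : Fin (r + 1), ∀ i, δ / 2 ≤ |s + (k : ℕ) * δ - γ i| := by
  by_contra! hcon
  choose g hg using hcon
  obtain ⟨k, l, hkl, hgkl⟩ := Fintype.exists_ne_map_eq_of_card_lt g (by simp)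
  have key : ∀ k l : Fin (r + 1), k < l → g k ≠ g l := by
    intro k l hkl he
    have h1 := abs_lt.1 (hg k)
    have h2 := abs_lt.1 (hg l)
    rw [he] at h1
    have h3 : ((k : ℕ) : ℝ) + 1 ≤ (l : ℕ) := by exact_mod_cast hkl
    nlinarith [h1.1, h2.2]
  rcases lt_or_gt_of_ne hkl with hlt | hlt
  · exact key k l hlt hgkl
  · exact key l k hlt hgkl.symm

theorem pow_le_eval_nodal_sq {r : ℕ} (s : Finset (Fin r)) {γ : Fin r → ℝ} {t d : ℝ} (hd : 0 < d)
    (hd1 : d ≤ 1) (h : ∀ i, d ≤ |t - γ i|) :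
    (d ^ 2) ^ r ≤ (Lagrange.nodal s γ).eval t ^ 2 := by
  have hsq : ∀ i, d ^ 2 ≤ (t - γ i) ^ 2 := fun i => by
    rw [← sq_abs (t - γ i)]
    exact pow_le_pow_left₀ hd.le (h i) 2
  rw [Lagrange.eval_nodal, ← Finset.prod_pow]
  calc (d ^ 2) ^ r ≤ (d ^ 2) ^ s.card :=
        pow_le_pow_of_le_one (by positivity) (pow_le_one₀ hd.le hd1)
          ((Finset.card_le_univ s).trans (Fintype.card_fin r).le)
    _ = ∏ _i ∈ s, d ^ 2 := by rw [Finset.prod_const]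
    _ ≤ ∏ i ∈ s, (t - γ i) ^ 2 := Finset.prod_le_prod (fun _ _ => by positivity) fun i _ => hsq i

theorem pow_mul_sq_le_eval_nodal_sq {r : ℕ} {s : Finset (Fin r)} {γ : Fin r → ℝ} {t d : ℝ}
    (hd : 0 < d) (hd1 : d ≤ 1) (h : ∀ i, d ≤ |t - γ i|) {i : Fin r} (hi : i ∈ s) :
    (d ^ 2) ^ r * (t - γ i) ^ 2 ≤ (Lagrange.nodal s γ).eval t ^ 2 := by
  rw [Lagrange.nodal_eq_mul_nodal_erase hi, eval_mul, mul_pow, mul_comm]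
  simp only [eval_sub, eval_X, eval_C]
  exact mul_le_mul_of_nonneg_left (pow_le_eval_nodal_sq _ hd hd1 h) (sq_nonneg _)

/-- The parameters are bounded along a sequence whose images converge in `posCone`. -/
theorem Admissible.eventually_mem_box {r : ℕ} {T : Set ℝ} {u v : ℝ[X]} (h : Admissible r T u v)
    {x : ℕ → (ℝ × ℝ) × (Fin r → ℝ)} (hx : ∀ k, x k ∈ paramDomain (r + 1) T)
    {c : Fin (r + 2) → ℝ} (hc : c ∈ posCone (r + 1) T)
    (hlim : Tendsto (fun k => coeffVec (r + 1) (weightedPoly u v (x k))) atTop (𝓝 c)) :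
    ∃ A B : ℝ, ∀ᶠ k in atTop,
      x k ∈ (Icc 0 A ×ˢ Icc 0 A) ×ˢ Icc (fun _ : Fin r => -B) (fun _ => B) := by
  obtain ⟨s, δ, hδ, hδ1, hsδ⟩ := exists_progression isOpen_interior h.nonempty_interior r
  have hmem : ∀ j : Fin (r + 1), s + (j : ℕ) * δ ∈ interior T := fun j =>
    hsδ j (Nat.lt_succ_iff.1 j.2)
  obtain ⟨M, hM⟩ : ∃ M : ℝ, ∀ k, ∀ j : Fin (r + 1),
      (weightedPoly u v (x k)).eval (s + (j : ℕ) * δ) ≤ M := by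
    have hcont : Continuous fun c : Fin (r + 2) → ℝ => ∑ j : Fin (r + 1),
        |∑ i : Fin (r + 2), c i * (s + (j : ℕ) * δ) ^ (i : ℕ)| := by fun_prop
    obtain ⟨M, hM⟩ := ((hcont.tendsto c).comp hlim).bddAbove_range
    refine ⟨M, fun k j => le_trans ?_ (hM ⟨k, rfl⟩)⟩
    simp only [Function.comp, sum_coeffVec (natDegree_weightedPoly_le h (x k))]
    exact (le_abs_self _).trans (Finset.single_le_sum (f := fun j : Fin (r + 1) =>
      |(weightedPoly u v (x k)).eval (s + (j : ℕ) * δ)|) (fun _ _ => abs_nonneg _)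
      (Finset.mem_univ j))
  obtain ⟨μ, hμ, hμuv⟩ : ∃ μ : ℝ, 0 < μ ∧ ∀ j : Fin (r + 1),
      μ ≤ u.eval (s + (j : ℕ) * δ) ∧ μ ≤ v.eval (s + (j : ℕ) * δ) := by
    obtain ⟨j, hj⟩ := Finite.exists_min fun j : Fin (r + 1) =>
      min (u.eval (s + (j : ℕ) * δ)) (v.eval (s + (j : ℕ) * δ))
    exact ⟨_, lt_min (h.u_pos _ (hmem j)) (h.v_pos _ (hmem j)), fun l => le_min_iff.1 (hj l)⟩
  have hd : 0 < δ / 2 := by positivity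
  have hd1 : δ / 2 ≤ 1 := by linarith
  set κ := ((δ / 2) ^ 2) ^ r with hκdef
  have hκ : 0 < κ := by positivity
  -- Evaluate at a sample point t at distance at least δ / 2 from all nodes. There f(t) ≤ M bounds
  -- both weights; if the weight of the term containing node i is at least l, then also l μ κ (t - γ
  -- i)² ≤ M.
  have hA : ∀ k, x k ∈ (Icc 0 (M / (μ * κ)) ×ˢ Icc 0 (M / (μ * κ))) ×ˢ (univ : Set (Fin r → ℝ)) ∧
      ∀ i, ∀ l : ℝ, 0 < l → (i ∈ oddNodes r ∧ l ≤ (x k).1.1 ∨ i ∈ evenNodes r ∧ l ≤ (x k).1.2) →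
        |(x k).2 i| ≤ |s| + r + 1 + M / (l * μ * κ) := by
    intro k
    obtain ⟨h1, h2, hγ⟩ := mem_paramDomain.1 (hx k)
    obtain ⟨j, hj⟩ := exists_far (x k).2 s hδ
    have hMj := hM k j
    obtain ⟨hu, hv⟩ := hμuv j
    set t := s + (j : ℕ) * δ with ht
    rw [eval_weightedPoly] at hMj
    have hP := pow_le_eval_nodal_sq (oddNodes r) hd hd1 hj
    have hQ := pow_le_eval_nodal_sq (evenNodes r) hd hd1 hj
    have hu0 := hμ.trans_le hu
    have hv0 := hμ.trans_le hv
    have hP0 : 0 ≤ (x k).1.1 * u.eval t * (oddProd (x k).2).eval t ^ 2 := by positivity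
    have hQ0 : 0 ≤ (x k).1.2 * v.eval t * (evenProd (x k).2).eval t ^ 2 := by positivity
    have ht' : |t| ≤ |s| + r := by
      refine (abs_add_le _ _).trans (add_le_add_right ?_ _)
      rw [abs_of_nonneg (by positivity)]
      have hj' : ((j : ℕ) : ℝ) ≤ r := by exact_mod_cast Nat.lt_succ_iff.1 j.2
      nlinarith
    refine ⟨⟨⟨⟨h1.le, ?_⟩, h2.le, ?_⟩, mem_univ _⟩, fun i l hl hi => ?_⟩
    · rw [le_div_iff₀ (by positivity)]
      calc (x k).1.1 * (μ * κ) ≤ (x k).1.1 * (u.eval t * (oddProd (x k).2).eval t ^ 2) := by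
            gcongr; exact hP
        _ ≤ M := by linarith
    · rw [le_div_iff₀ (by positivity)]
      calc (x k).1.2 * (μ * κ) ≤ (x k).1.2 * (v.eval t * (evenProd (x k).2).eval t ^ 2) := by
            gcongr; exact hQ
        _ ≤ M := by linarith
    · have hsq : (t - (x k).2 i) ^ 2 ≤ M / (l * μ * κ) := by
        rw [le_div_iff₀ (by positivity)]
        rcases hi with ⟨hi, hil⟩ | ⟨hi, hil⟩
        · have hP' := pow_mul_sq_le_eval_nodal_sq hd hd1 hj hi
          calc (t - (x k).2 i) ^ 2 * (l * μ * κ) = l * μ * (κ * (t - (x k).2 i) ^ 2) := by ring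
            _ ≤ (x k).1.1 * u.eval t * (oddProd (x k).2).eval t ^ 2 := by
              gcongr; exact hP'
            _ ≤ M := by linarith
        · have hQ' := pow_mul_sq_le_eval_nodal_sq hd hd1 hj hi
          calc (t - (x k).2 i) ^ 2 * (l * μ * κ) = l * μ * (κ * (t - (x k).2 i) ^ 2) := by ring
            _ ≤ (x k).1.2 * v.eval t * (evenProd (x k).2).eval t ^ 2 := by
              gcongr; exact hQ'
            _ ≤ M := by linarith
      have h3 : |t - (x k).2 i| ≤ 1 + (t - (x k).2 i) ^ 2 := by
        rw [← sq_abs (t - (x k).2 i)]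
        nlinarith [sq_nonneg (|t - (x k).2 i| - 1), abs_nonneg (t - (x k).2 i)]
      have h4 : |(x k).2 i| ≤ |t| + |t - (x k).2 i| := by
        have := abs_sub t (t - (x k).2 i)
        rwa [sub_sub_cancel] at this
      linarith
  -- The top coefficient is one of the two weights. Its limit is positive, so that weight is
  -- eventually at least half the limit, which bounds the nodes of its term.
  have hbound : ¬ BddAbove T → ∃ B : ℝ, ∀ᶠ k in atTop, ∀ i,
      (Odd r ∧ i ∈ oddNodes r ∨ Even r ∧ i ∈ evenNodes r) → |(x k).2 i| ≤ B := by
    intro hT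
    have hl := hc.2 hT
    have hcoeff : Tendsto (fun k => (weightedPoly u v (x k)).coeff (r + 1)) atTop
      (𝓝 (c (Fin.last (r + 1)))) := ((continuous_apply (Fin.last (r + 1))).tendsto c).comp hlim
    refine ⟨|s| + r + 1 + M / (c (Fin.last (r + 1)) / 2 * μ * κ), ?_⟩
    · filter_upwards [hcoeff.eventually_const_le (half_lt_self hl)] with k hk i hi
      rw [h.coeff_weightedPoly hT] at hk
      refine (hA k).2 i _ (half_pos hl) ?_
      rcases hi with ⟨hr, hi⟩ | ⟨hr, hi⟩
      · rw [if_pos hr] at hk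
        exact Or.inl ⟨hi, hk⟩
      · rw [if_neg (Nat.not_odd_iff_even.2 hr)] at hk
        exact Or.inr ⟨hi, hk⟩
  have hupper : ∃ B : ℝ, ∀ᶠ k in atTop, ∀ i, (x k).2 i ≤ B := by
    by_cases hT : BddAbove T
    · obtain ⟨B, hB⟩ := hT
      exact ⟨B, Eventually.of_forall fun k i =>
        hB (interior_subset ((mem_paramDomain.1 (hx k)).2.2.1 i))⟩
    · obtain ⟨B, hB⟩ := hbound hT
      refine ⟨B, hB.mono fun k hk i => ?_⟩
      have hr : r - 1 < r := Nat.sub_lt (i.pos) one_pos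
      -- The last node, with zero-based index r - 1, always belongs to the controlled term and
      -- dominates all others.
      have hlast : Odd r ∧ (⟨r - 1, hr⟩ : Fin r) ∈ oddNodes r ∨
          Even r ∧ (⟨r - 1, hr⟩ : Fin r) ∈ evenNodes r := by
        simp only [Finset.mem_filter, Finset.mem_univ, true_and]
        rcases Nat.even_or_odd r with hr' | hr'
        · exact Or.inr ⟨hr', Nat.Even.sub_odd (by omega) hr' odd_one⟩
        · exact Or.inl ⟨hr', Nat.Odd.sub_odd hr' odd_one⟩
      refine le_trans ?_ ((le_abs_self _).trans (hk _ hlast))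
      exact (mem_paramDomain.1 (hx k)).2.2.2.monotone (Fin.le_def.2 (by simp; omega))
  have hlower : ∃ B : ℝ, ∀ᶠ k in atTop, ∀ i, B ≤ (x k).2 i := by
    rcases h.bddBelow_or with hT | ⟨hr, hT⟩
    · obtain ⟨B, hB⟩ := hT
      exact ⟨B, Eventually.of_forall fun k i =>
        hB (interior_subset ((mem_paramDomain.1 (hx k)).2.2.1 i))⟩
    · obtain ⟨B, hB⟩ := hbound hT
      -- For odd r the first node is in the controlled term too, which replaces a lower bound of T.
      refine ⟨-B, hB.mono fun k hk i => ?_⟩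
      refine le_trans (neg_le_of_abs_le (hk ⟨0, i.pos⟩ (Or.inl ⟨hr, by simp⟩))) ?_
      exact (mem_paramDomain.1 (hx k)).2.2.2.monotone (Fin.le_def.2 (by simp))
  obtain ⟨B, hB⟩ := hupper
  obtain ⟨B', hB'⟩ := hlower
  refine ⟨M / (μ * κ), max |B| |B'|, ?_⟩
  filter_upwards [hB, hB'] with k hk hk'
  refine ⟨(hA k).1.1, fun i => ?_, fun i => ?_⟩
  · exact (neg_le_neg (le_max_right _ _)).trans ((neg_abs_le B').trans (hk' i))
  · exact (hk i).trans ((le_abs_self B).trans (le_max_left _ _))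

/-! ### Limits of parameters and closedness of the image -/

/-- Parameters in the closure of the domain lie in the domain if the polynomial that they represent
is positive. -/
theorem Admissible.mem_paramDomain_of_mem_posCone {r : ℕ} {T : Set ℝ} {u v : ℝ[X]}
    (h : Admissible r T u v) {x : (ℝ × ℝ) × (Fin r → ℝ)} (h1 : 0 ≤ x.1.1) (h2 : 0 ≤ x.1.2)
    (hmono : Monotone x.2) (hT : ∀ i, x.2 i ∈ T)
    (hc : coeffVec (r + 1) (weightedPoly u v x) ∈ posCone (r + 1) T) :
    x ∈ paramDomain (r + 1) T := by
  have hpos : ∀ t ∈ T, 0 < x.1.1 * u.eval t * (oddProd x.2).eval t ^ 2 +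
      x.1.2 * v.eval t * (evenProd x.2).eval t ^ 2 := fun t ht => by
    have := hc.1 t ht
    rwa [sum_coeffVec (natDegree_weightedPoly_le h x), eval_weightedPoly] at this
  have hlead : ¬ BddAbove T → 0 < if Odd r then x.1.1 else x.1.2 := fun hT => by
    rw [← h.coeff_weightedPoly hT x]
    exact hc.2 hT
  have hne : ∀ t ∈ T, u.eval t = 0 ∨ (oddProd x.2).eval t = 0 →
      v.eval t = 0 ∨ (evenProd x.2).eval t = 0 → False := by
    intro t ht hP hQ
    have := hpos t ht
    rcases hP with hP | hP <;> rcases hQ with hQ | hQ <;> simp [hP, hQ] at this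
  have hodd : ∀ {i : Fin r}, Even i.val → (oddProd x.2).eval (x.2 i) = 0 := fun hi =>
    Lagrange.eval_nodal_at_node (by simpa using hi)
  have heven : ∀ {i : Fin r}, Odd i.val → (evenProd x.2).eval (x.2 i) = 0 := fun hi =>
    Lagrange.eval_nodal_at_node (by simpa using hi)
  -- By monotonicity a coincidence forces two neighbouring nodes to coincide; having opposite
  -- parity, they make both terms vanish.
  have hsucc : ∀ i j : Fin r, i < j → x.2 i ≠ x.2 j := by
    intro i j hij he
    have hk : i.val + 1 < r := lt_of_le_of_lt (Nat.succ_le_of_lt hij) j.2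
    have hk2 : x.2 ⟨i.val + 1, hk⟩ = x.2 i :=
      le_antisymm (he ▸ hmono (Fin.le_def.2 (Nat.succ_le_of_lt hij)))
        (hmono (Fin.le_def.2 (Nat.le_succ _)))
    rcases Nat.even_or_odd i.val with hi | hi
    · exact hne _ (hT i) (Or.inr (hodd hi)) (Or.inr (hk2 ▸ heven hi.add_one))
    · exact hne _ (hT i) (Or.inr (hk2 ▸ hodd hi.add_one)) (Or.inr (heven hi))
  have hinj : Function.Injective x.2 := by
    intro i j he
    rcases lt_trichotomy i j with hij | hij | hij
    · exact absurd he (hsucc i j hij)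
    · exact hij
    · exact absurd he.symm (hsucc j i hij)
  refine mem_paramDomain.2 ⟨?_, ?_, fun i => ?_, hmono.strictMono_of_injective hinj⟩
  -- If α = 0, then f vanishes at the least point of T, where v does; in the remaining case the top
  -- coefficient is α.
  · refine lt_of_le_of_ne h1 fun h0 => ?_
    rcases h.bddBelow_or with hb | ⟨hr, hb⟩
    · have hl := h.isClosed.isLeast_csInf (h.nonempty_interior.mono interior_subset) hb
      have := hpos _ hl.1
      rw [← h0, h.eval_least _ hl] at this
      simp at this
    · have := hlead hb
      rw [if_pos hr] at this
      linarith
  -- If β = 0, then f vanishes at the first node. With no node, use a zero of u at the greatest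
  -- point, or the top coefficient.
  · refine lt_of_le_of_ne h2 fun h0 => ?_
    rcases Nat.eq_zero_or_pos r with rfl | hr
    · by_cases hb : BddAbove T
      · have hl := h.isClosed.isGreatest_csSup (h.nonempty_interior.mono interior_subset) hb
        have := hpos _ hl.1
        rw [← h0, h.eval_greatest_even Even.zero _ hl] at this
        simp at this
      · have := hlead hb
        rw [if_neg Nat.not_odd_zero] at this
        linarith
    · have := hpos _ (hT ⟨0, hr⟩)
      rw [← h0, hodd (i := ⟨0, hr⟩) Even.zero] at this
      simp at this
  -- A node at an endpoint of T pushes the first or last node there, and the weight of the other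
  -- term vanishes at that endpoint.
  · rcases h.boundary _ (hT i) with hi | hi | hi
    · exact hi
    · refine (hne _ hi.1 (Or.inr ?_) (Or.inl (h.eval_least _ hi))).elim
      have : x.2 ⟨0, i.pos⟩ = x.2 i :=
        le_antisymm (hmono (Fin.le_def.2 (Nat.zero_le _))) (hi.2 (hT _))
      rw [← this]
      exact hodd Even.zero
    · have hl : r - 1 < r := Nat.sub_lt i.pos one_pos
      have hle : i ≤ ⟨r - 1, hl⟩ := Fin.le_def.2 (Nat.le_sub_one_of_lt i.2)
      have he : x.2 ⟨r - 1, hl⟩ = x.2 i := le_antisymm (hi.2 (hT _)) (hmono hle)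
      rcases Nat.even_or_odd r with hr | hr
      · refine (hne _ hi.1 (Or.inl (h.eval_greatest_even hr _ hi)) (Or.inr ?_)).elim
        rw [← he]
        exact heven (Nat.Even.sub_odd i.pos hr odd_one)
      · refine (hne _ hi.1 (Or.inr ?_) (Or.inl (h.eval_greatest_odd hr _ hi))).elim
        rw [← he]
        exact hodd (Nat.Odd.sub_odd hr odd_one)

theorem Admissible.closure_image_inter_posCone_subset {r : ℕ} {T : Set ℝ} {u v : ℝ[X]}
    (h : Admissible r T u v) :
    closure ((fun x : (ℝ × ℝ) × (Fin r → ℝ) => coeffVec (r + 1) (weightedPoly u v x)) ''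
      paramDomain (r + 1) T) ∩ posCone (r + 1) T ⊆
      (fun x => coeffVec (r + 1) (weightedPoly u v x)) '' paramDomain (r + 1) T := by
  rintro c ⟨hcl, hc⟩
  obtain ⟨y, hy, hyc⟩ := mem_closure_iff_seq_limit.1 hcl
  choose x hx hxy using hy
  replace hyc : Tendsto (fun k => coeffVec (r + 1) (weightedPoly u v (x k))) atTop (𝓝 c) := by
    refine hyc.congr fun k => ?_
    exact (hxy k).symm
  obtain ⟨A, B, hbox⟩ := h.eventually_mem_box hx hc hyc
  obtain ⟨a, -, σ, hσ, hlim⟩ := ((isCompact_Icc.prod isCompact_Icc).prod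
    isCompact_Icc).tendsto_subseq' hbox.frequently
  have hac : coeffVec (r + 1) (weightedPoly u v a) = c :=
    tendsto_nhds_unique
      (((contDiff_coeffVec_weightedPoly (r + 1) u v).continuous.tendsto a).comp hlim)
      (hyc.comp hσ.tendsto_atTop)
  have hD : ∀ k, 0 < (x (σ k)).1.1 ∧ 0 < (x (σ k)).1.2 ∧ (x (σ k)).2 ∈ Simplex r T := fun k =>
    mem_paramDomain.1 (hx (σ k))
  have hγ : ∀ i, Tendsto (fun k => (x (σ k)).2 i) atTop (𝓝 (a.2 i)) := fun i =>
    (((continuous_apply i).comp continuous_snd).tendsto a).comp hlim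
  refine ⟨a, h.mem_paramDomain_of_mem_posCone ?_ ?_ ?_ ?_ (hac ▸ hc), hac⟩
  · exact ge_of_tendsto' (((continuous_fst.comp continuous_fst).tendsto a).comp hlim)
      fun k => (hD k).1.le
  · exact ge_of_tendsto' (((continuous_snd.comp continuous_fst).tendsto a).comp hlim)
      fun k => (hD k).2.1.le
  · exact fun i j hij => le_of_tendsto_of_tendsto' (hγ i) (hγ j)
      fun k => (hD k).2.2.2.monotone hij
  · exact fun i => h.isClosed.mem_of_tendsto (hγ i)
      (Eventually.of_forall fun k => interior_subset ((hD k).2.2.1 i))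

/-! ### The image is the whole positive part -/

theorem Admissible.paramDomain_nonempty {r : ℕ} {T : Set ℝ} {u v : ℝ[X]}
    (h : Admissible r T u v) : (paramDomain (r + 1) T).Nonempty := by
  obtain ⟨s, δ, hδ, -, hsδ⟩ := exists_progression isOpen_interior h.nonempty_interior r
  refine ⟨((1, 1), fun i : Fin r => s + (i : ℕ) * δ), mem_paramDomain.2
    ⟨one_pos, one_pos, fun i => hsδ i i.2.le, fun i j hij => ?_⟩⟩
  have : ((i : ℕ) : ℝ) < (j : ℕ) := by exact_mod_cast hij
  simpa using mul_lt_mul_of_pos_right this hδ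

/-- A nonempty, open and relatively closed subset of a connected set is everything; convexity
supplies connectedness. -/
theorem Admissible.image_eq_posCone {r : ℕ} {T : Set ℝ} {u v : ℝ[X]} (h : Admissible r T u v) :
    (fun x : (ℝ × ℝ) × (Fin r → ℝ) => coeffVec (r + 1) (weightedPoly u v x)) ''
      paramDomain (r + 1) T = posCone (r + 1) T := by
  refine h.image_subset_posCone.antisymm ?_
  refine (convex_posCone (r + 1) T).isPreconnected.subset_of_closure_inter_subset
    h.isDiffeoOn.2.1 ?_ h.closure_image_inter_posCone_subset
  rw [inter_eq_right.2 h.image_subset_posCone]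
  exact h.paramDomain_nonempty.image _

theorem Admissible.isAERepresentation {r : ℕ} {T : Set ℝ} {u v : ℝ[X]}
    (h : Admissible r T u v) : IsAERepresentation (r + 1) T
      (fun x : (ℝ × ℝ) × (Fin r → ℝ) => coeffVec (r + 1) (weightedPoly u v x)) := by
  refine ⟨?_, h.isDiffeoOn.2.2.1.injOn, h.isDiffeoOn⟩
  rw [h.image_eq_posCone]
  exact cone_ae_eq_posCone (r + 1) T

/-! ### The three kinds of intervals -/

/-- Needed for odd n, where the first weight belongs to the even-numbered nodes, whereas in
`weightedPoly` it belongs to the odd-numbered ones. -/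
theorem IsAERepresentation.comp_swap {n : ℕ} {T : Set ℝ}
    {φ : (ℝ × ℝ) × (Fin (n - 1) → ℝ) → Fin (n + 1) → ℝ} (h : IsAERepresentation n T φ) :
    IsAERepresentation n T (fun x => φ (x.1.swap, x.2)) := by
  obtain ⟨hae, hinj, hs, ht, hbij, hφ, g, hg, hgs⟩ := h
  set σ : (ℝ × ℝ) × (Fin (n - 1) → ℝ) → (ℝ × ℝ) × (Fin (n - 1) → ℝ) :=
    fun x => (x.1.swap, x.2) with hσ
  have hσσ : ∀ x, σ (σ x) = x := fun x => rfl
  have hmaps : MapsTo σ (paramDomain n T) (paramDomain n T) := fun x hx =>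
    ⟨⟨hx.1.2, hx.1.1⟩, hx.2⟩
  have himage : σ '' paramDomain n T = paramDomain n T :=
    hmaps.image_subset.antisymm fun x hx => ⟨σ x, hmaps hx, hσσ x⟩
  have hσinj : Function.Injective σ := Function.LeftInverse.injective hσσ
  have hsmooth : ContDiff ℝ ∞ σ :=
    ((contDiff_snd.comp contDiff_fst).prodMk (contDiff_fst.comp contDiff_fst)).prodMk contDiff_snd
  have himage' : (fun x => φ (σ x)) '' paramDomain n T = φ '' paramDomain n T := by
    conv_rhs => rw [← himage]
    rw [image_image]
  have hinj' : InjOn (fun x => φ (σ x)) (paramDomain n T) := hinj.comp hσinj.injOn hmaps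
  refine ⟨himage' ▸ hae, hinj', hs, himage' ▸ ht, hinj'.bijOn_image,
    hφ.comp hsmooth.contDiffOn hmaps, σ ∘ g, fun x hx => ?_, ?_⟩
  · exact (congrArg σ (hg (hmaps hx))).trans (hσσ x)
  · rw [himage']
    exact hsmooth.comp_contDiffOn hgs

theorem natDegree_C_sub_X (b : ℝ) : (C b - X : ℝ[X]).natDegree = 1 := by
  rw [← neg_sub X (C b), natDegree_neg, natDegree_X_sub_C]

theorem isLeast_Icc_or_isGreatest_Icc {a b : ℝ} (hab : a < b) {t : ℝ} (ht : t ∈ Icc a b) :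
    t ∈ interior (Icc a b) ∨ IsLeast (Icc a b) t ∨ IsGreatest (Icc a b) t := by
  rcases ht.1.eq_or_lt with rfl | h1
  · exact Or.inr (Or.inl (isLeast_Icc hab.le))
  rcases ht.2.eq_or_lt with rfl | h2
  · exact Or.inr (Or.inr (isGreatest_Icc hab.le))
  · exact Or.inl (by rw [interior_Icc]; exact ⟨h1, h2⟩)

theorem admissible_Icc_odd {r : ℕ} (hr : Odd r) {a b : ℝ} (hab : a < b) :
    Admissible r (Icc a b) 1 ((X - C a) * (C b - X)) where
  ordConnected := ordConnected_Icc
  isClosed := isClosed_Icc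
  nonempty_interior := by rw [interior_Icc]; exact nonempty_Ioo.2 hab
  u_nonneg := by simp
  v_nonneg t ht := by
    simpa using mul_nonneg (sub_nonneg.2 ht.1) (sub_nonneg.2 ht.2)
  u_pos := by simp
  v_pos t ht := by
    rw [interior_Icc] at ht
    simpa using mul_pos (sub_pos.2 ht.1) (sub_pos.2 ht.2)
  isCoprime := isCoprime_one_left
  natDegree_u := by rw [natDegree_one]; omega
  natDegree_v := by
    have : ((X - C a) * (C b - X) : ℝ[X]).natDegree ≤ 1 + 1 := by
      refine natDegree_mul_le.trans ?_
      rw [natDegree_X_sub_C, natDegree_C_sub_X]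
    obtain ⟨m, rfl⟩ := hr
    omega
  odd_or := Or.inl hr
  boundary _ ht := isLeast_Icc_or_isGreatest_Icc hab ht
  eval_least t ht := by rw [ht.unique (isLeast_Icc hab.le)]; simp
  eval_greatest_odd _ t ht := by rw [ht.unique (isGreatest_Icc hab.le)]; simp
  eval_greatest_even h := absurd h (Nat.not_even_iff_odd.2 hr)
  u_eq_one h := absurd bddAbove_Icc h
  natDegree_v_le h := absurd bddAbove_Icc h
  v_monic h := absurd bddAbove_Icc h
  bddBelow_or := Or.inl bddBelow_Icc

theorem admissible_Icc_even {r : ℕ} (hr : Even r) {a b : ℝ} (hab : a < b) :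
    Admissible r (Icc a b) (C b - X) (X - C a) where
  ordConnected := ordConnected_Icc
  isClosed := isClosed_Icc
  nonempty_interior := by rw [interior_Icc]; exact nonempty_Ioo.2 hab
  u_nonneg t ht := by simpa using ht.2
  v_nonneg t ht := by simpa using ht.1
  u_pos t ht := by
    rw [interior_Icc] at ht
    simpa using ht.2
  v_pos t ht := by
    rw [interior_Icc] at ht
    simpa using ht.1
  isCoprime := by
    rw [← neg_sub X (C b), IsCoprime.neg_left_iff]
    exact isCoprime_X_sub_C_of_isUnit_sub (sub_ne_zero.2 hab.ne').isUnit
  natDegree_u := by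
    rw [natDegree_C_sub_X]
    obtain ⟨m, rfl⟩ := hr
    omega
  natDegree_v := by
    rw [natDegree_X_sub_C]
    omega
  odd_or := Or.inr (natDegree_X_sub_C a)
  boundary _ ht := isLeast_Icc_or_isGreatest_Icc hab ht
  eval_least t ht := by rw [ht.unique (isLeast_Icc hab.le)]; simp
  eval_greatest_odd h := absurd hr (Nat.not_even_iff_odd.2 h)
  eval_greatest_even _ t ht := by rw [ht.unique (isGreatest_Icc hab.le)]; simp
  u_eq_one h := absurd bddAbove_Icc h
  natDegree_v_le h := absurd bddAbove_Icc h
  v_monic h := absurd bddAbove_Icc h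
  bddBelow_or := Or.inl bddBelow_Icc

theorem admissible_Ici (r : ℕ) (a : ℝ) : Admissible r (Ici a) 1 (X - C a) where
  ordConnected := ordConnected_Ici
  isClosed := isClosed_Ici
  nonempty_interior := by rw [interior_Ici]; exact nonempty_Ioi
  u_nonneg := by simp
  v_nonneg t ht := by simpa using ht
  u_pos := by simp
  v_pos t ht := by
    rw [interior_Ici] at ht
    simpa using ht
  isCoprime := isCoprime_one_left
  natDegree_u := by rw [natDegree_one]; omega
  natDegree_v := by
    rw [natDegree_X_sub_C]
    omega
  odd_or := Or.inr (natDegree_X_sub_C a)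
  boundary t ht := by
    rw [interior_Ici]
    rcases (mem_Ici.1 ht).eq_or_lt with rfl | h
    · exact Or.inr (Or.inl isLeast_Ici)
    · exact Or.inl h
  eval_least t ht := by rw [ht.unique isLeast_Ici]; simp
  eval_greatest_odd _ t ht := absurd ⟨t, ht.2⟩ (not_bddAbove_Ici a)
  eval_greatest_even _ t ht := absurd ⟨t, ht.2⟩ (not_bddAbove_Ici a)
  u_eq_one _ := rfl
  natDegree_v_le _ := (natDegree_X_sub_C a).le
  v_monic _ _ := monic_X_sub_C a
  bddBelow_or := Or.inl bddBelow_Ici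

theorem admissible_univ {r : ℕ} (hr : Odd r) : Admissible r univ 1 1 where
  ordConnected := ordConnected_univ
  isClosed := isClosed_univ
  nonempty_interior := by rw [interior_univ]; exact univ_nonempty
  u_nonneg := by simp
  v_nonneg := by simp
  u_pos := by simp
  v_pos := by simp
  isCoprime := isCoprime_one_left
  natDegree_u := by rw [natDegree_one]; omega
  natDegree_v := by rw [natDegree_one]; omega
  odd_or := Or.inl hr
  boundary t _ := by simp
  eval_least t ht := absurd ⟨t, ht.2⟩ not_bddBelow_univ
  eval_greatest_odd _ t ht := absurd ⟨t, ht.2⟩ not_bddAbove_univ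
  eval_greatest_even h := absurd h (Nat.not_even_iff_odd.2 hr)
  u_eq_one _ := rfl
  natDegree_v_le _ := by simp
  v_monic _ _ := monic_one
  bddBelow_or := Or.inr ⟨hr, not_bddAbove_univ⟩

end PositivePolynomial

end

theorem mainTheorem5 (n : ℕ) (hn : 1 ≤ n) :
    (∀ a b : ℝ, a < b →
      PositivePolynomial.IsAERepresentation n (Icc a b)
        (fun x => PositivePolynomial.coeffVec n (PositivePolynomial.polyIcc n a b x))) ∧
    (∀ a : ℝ,
      PositivePolynomial.IsAERepresentation n (Ici a)
        (fun x => PositivePolynomial.coeffVec n (PositivePolynomial.polyIci n a x))) ∧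
    (Even n →
      PositivePolynomial.IsAERepresentation n univ
        (fun x => PositivePolynomial.coeffVec n (PositivePolynomial.polyUniv n x))) := by
  obtain ⟨r, rfl⟩ : ∃ r, n = r + 1 := ⟨n - 1, by omega⟩
  refine ⟨fun a b hab => ?_, fun a => ?_, fun hr => ?_⟩
  · by_cases hr : Even (r + 1)
    · have h := (PositivePolynomial.admissible_Icc_odd
        (by simpa [Nat.even_add_one] using hr) hab).isAERepresentation
      convert h using 3 with x
      rw [PositivePolynomial.polyIcc, if_pos hr, PositivePolynomial.oddSq_eq,
        PositivePolynomial.evenSq_eq, PositivePolynomial.weightedPoly, mul_one,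
        PositivePolynomial.oddProd, PositivePolynomial.evenProd, mul_assoc (Polynomial.C x.1.2)]
      rfl
    · have h := (PositivePolynomial.admissible_Icc_even
        (by simpa [Nat.even_add_one] using hr) hab).isAERepresentation.comp_swap
      convert h using 3 with x
      rw [PositivePolynomial.polyIcc, if_neg hr, PositivePolynomial.oddSq_eq,
        PositivePolynomial.evenSq_eq, PositivePolynomial.weightedPoly,
        PositivePolynomial.oddProd, PositivePolynomial.evenProd, add_comm]
      rfl
  · have h := (PositivePolynomial.admissible_Ici r a).isAERepresentation
    by_cases hr : Even (r + 1)
    · convert h using 3 with x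
      rw [PositivePolynomial.polyIci, if_pos hr, PositivePolynomial.oddSq_eq,
        PositivePolynomial.evenSq_eq, PositivePolynomial.weightedPoly, mul_one,
        PositivePolynomial.oddProd, PositivePolynomial.evenProd]
      rfl
    · convert h.comp_swap using 3 with x
      rw [PositivePolynomial.polyIci, if_neg hr, PositivePolynomial.oddSq_eq,
        PositivePolynomial.evenSq_eq, PositivePolynomial.weightedPoly, mul_one,
        PositivePolynomial.oddProd, PositivePolynomial.evenProd, add_comm]
      rfl
  · have h := (PositivePolynomial.admissible_univ
      (by simpa [Nat.even_add_one] using hr)).isAERepresentation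
    convert h using 3 with x
    rw [PositivePolynomial.polyUniv, PositivePolynomial.oddSq_eq,
      PositivePolynomial.evenSq_eq, PositivePolynomial.weightedPoly, mul_one, mul_one,
      PositivePolynomial.oddProd, PositivePolynomial.evenProd]
    rfl
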